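/- **Setting.** Let $p\ge 1$, $0<b<1$ and $0<\varepsilon<\min\{b,1-b\}$. Let $H_0$ be the distribution of $(y,\mathbf x)\in\mathbb R\times\mathbb R^p$ under which $y,x_1,\dots,x_p$ are independent standard Cauchy variables (the true intercept and slopes being zero), and let $V_\varepsilon=\{(1-\varepsilon)H_0+\varepsilon H^*: H^* \text{ a probability measure on } \mathbb R^{p+1}\}$. For an $\mathbb R^p$-valued functional $\mathbf T$ defined on $V_\varepsilon$ put $B_{\mathbf T}(\varepsilon)=\sup_{H\in V_\varepsilon}\|\mathbf T(H)\|\in[0,\infty]$ (Euclidean norm). A *loss function* is an even function $\rho:\mathbb R\to\mathbb R$, nondecreasing on $[0,\infty)$, with $\rho(0)=0$, $\lim_{u\to\infty}\rho(u)=1$ and finitely many discontinuities. For such a $\rho$, the scales $\sigma>0$ with $E_H\rho((y-\alpha-\mathbf x'\boldsymbol\theta)/\sigma)\le b$ are called feasible at $(\alpha,\boldsymbol\theta)$ for $H$; solutions $(\alpha,\boldsymbol\theta)$ below are required to have a feasible scale, and compete with all those that do. * $\mathbf T$ is an *S-estimate* if for every $H\in V_\varepsilon$ there is $\alpha$ such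 that $(\alpha,\mathbf T(H))$ minimizes the infimum of the feasible scales. * For $c>0$, $\mathbf T$ is a *CM-estimate* if for every $H\in V_\varepsilon$ there is $\alpha$ such that $(\alpha,\mathbf T(H))$ minimizes the infimum, over the feasible scales $\sigma$, of $c\,E_H\rho((y-\alpha-\mathbf x'\boldsymbol\theta)/\sigma)+\log\sigma$. * For loss functions $\rho_1\ge\rho_2$, let $s(H)$ be the infimum of all scales feasible for $\rho_1$ at some $(\alpha,\boldsymbol\theta)$. $\mathbf T$ is an *MM-estimate* if for every $H\in V_\varepsilon$ there is $\alpha$ such that $(\alpha,\mathbf T(H))$ minimizes $E_H\rho_2((y-\alpha-\mathbf x'\boldsymbol\theta)/s(H))$ over $\mathbb R\times\mathbb R^p$. For a loss function $\rho$ let $g(s)=E\rho(Z/s)$, $s>0$, with $Z$ standard Cauchy, and let $g^{-1}(v)=\inf\{s>0: g(s)\le v\}$ be its inverse (so $g^{-1}(v)=0$ if $v\ge 1$). Put $\sigma_{b,\varepsilon}=g^{-1}[(b-\varepsilon)/(1-\varepsilon)]$ and $\gamma_{b,\varepsilon}=g^{-1}[b/(1-\varepsilon)]$; it is assumed throughout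 that $(b-\varepsilon)/(1-\varepsilon)$ is a value of $g$ on $(0,\infty)$ (automatic if $\rho$ is continuous at $0$). Let $A_{c,\varepsilon}(s)=c(1-\varepsilon)g(s)+\log s$ and $D_c(\varepsilon)=\inf_{s\ge\sigma_{b,\varepsilon}}A_{c,\varepsilon}(s)-\inf_{s\ge\gamma_{b,\varepsilon}}A_{c,\varepsilon}(s)$. **Statement.** 1. Every S-estimate $\mathbf T_S$ based on $\rho$ satisfies $B_S(\varepsilon)=\sigma_{b,\varepsilon}/\gamma_{b,\varepsilon}-1$. 2. Every CM-estimate $\mathbf T_{CM}$ based on $\rho$ and $c>0$ satisfies $B_{CM}(\varepsilon)=\exp\{D_c(\varepsilon)+c\varepsilon\}-1$. 3. Let $\rho_1\ge\rho_2$ be loss functions, let $g_1,g_2$ be the corresponding functions $g$, and define $\sigma_{b,\varepsilon},\gamma_{b,\varepsilon}$ through $g_1$ (with $(b-\varepsilon)/(1-\varepsilon)$ a value of $g_1$ on $(0,\infty)$). Let $\bar s=\sup_{H\in V_\varepsilon}s(H)$ and $$h_1(t)=\inf_{\|\boldsymbol\theta\|=t}\inf_{\alpha}E_{H_0}\rho_2\Big(\frac{y-\alpha-\mathbf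 x'\boldsymbol\theta}{\bar s}\Big)-E_{H_0}\rho_2\Big(\frac y{\bar s}\Big),\qquad t\ge0,$$ with inverse $h_1^{-1}(v)=\inf\{t\ge 0: h_1(t)\ge v\}$. Assume that an S-estimate based on $\rho_1$ has maximum bias $B_S(\varepsilon)<h_1^{-1}[\varepsilon/(1-\varepsilon)]$, that $g_2$ is continuously differentiable on $(0,\infty)$, and that $\phi_2(s)=-s\,g_2'(s)$ is unimodal (nondecreasing on $(0,\sigma_M]$ and nonincreasing on $[\sigma_M,\infty)$ for some $\sigma_M>0$). Then every MM-estimate $\mathbf T_{MM}$ based on $(\rho_1,\rho_2)$ satisfies $$\ell(\varepsilon)\le B_{MM}(\varepsilon)\le\max\{\ell(\varepsilon),u(\varepsilon)\},$$ where $$\ell(\varepsilon)=\frac{\sigma_{b,\varepsilon}}{g_2^{-1}[g_2(\sigma_{b,\varepsilon})+\varepsilon/(1-\varepsilon)]}-1,\qquad u(\varepsilon)=\frac{\gamma_{b,\varepsilon}}{g_2^{-1}[g_2(\gamma_{b,\varepsilon})+\varepsilon/(1-\varepsilon)]}-1,$$ and $u(\varepsilon)=\infty$ if $g_2(\gamma_{b,\varepsilon})+\varepsilon/(1-\varepsilon)\ge1$.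 -/

import Mathlib

open MeasureTheory ProbabilityTheory
open scoped ENNReal

noncomputable section

namespace CauchyRegression

/-- The space `ℝ × ℝᵖ` of observations `(y, x)`; `ℝᵖ` carries the Euclidean norm. -/
abbrev Obs (p : ℕ) : Type := ℝ × EuclideanSpace ℝ (Fin p)

/-- The standard Cauchy distribution on `ℝ`. -/
def stdCauchy : Measure ℝ := cauchyMeasure 0 1

instance : IsProbabilityMeasure stdCauchy := by
  unfold stdCauchy
  infer_instance

/-- The central model `H₀`: the response `y` (equal to the error, the true parameters being zero)
and the `p` regressors are independent standard Cauchy variables. -/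
def cauchyModel (p : ℕ) : Measure (Obs p) :=
  stdCauchy.prod ((Measure.pi fun _ : Fin p => stdCauchy).map (WithLp.toLp 2))

/-- The `ε`-contamination neighbourhood `V_ε` of the Cauchy model. -/
def contamination (p : ℕ) (ε : ℝ) : Set (Measure (Obs p)) :=
  {H | ∃ Hstar : Measure (Obs p), IsProbabilityMeasure Hstar ∧
    H = ENNReal.ofReal (1 - ε) • cauchyModel p + ENNReal.ofReal ε • Hstar}

/-- The maximum asymptotic bias over `V_ε` of a slope functional. -/
def maxBias {p : ℕ} (T : Measure (Obs p) → EuclideanSpace ℝ (Fin p)) (ε : ℝ) : ℝ≥0∞ :=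
  ⨆ H ∈ contamination p ε, ENNReal.ofReal ‖T H‖

/-- Bounded loss functions. -/
structure IsLoss (ρ : ℝ → ℝ) : Prop where
  symm : ∀ u, ρ (-u) = ρ u
  monotoneOn : MonotoneOn ρ (Set.Ici 0)
  map_zero : ρ 0 = 0
  tendsto_one : Filter.Tendsto ρ Filter.atTop (nhds 1)
  finite_discontinuities : {u | ¬ ContinuousAt ρ u}.Finite

/-- The expected loss `E_H ρ((y - α - x'θ) / σ)`. -/
def risk {p : ℕ} (ρ : ℝ → ℝ) (H : Measure (Obs p)) (α : ℝ) (θ : EuclideanSpace ℝ (Fin p))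
    (σ : ℝ) : ℝ :=
  ∫ z, ρ ((z.1 - α - inner ℝ z.2 θ) / σ) ∂H

/-- The scales `σ > 0` for which the constraint `E_H ρ((y - α - x'θ) / σ) ≤ b` holds. -/
def feasibleScales {p : ℕ} (ρ : ℝ → ℝ) (b : ℝ) (H : Measure (Obs p)) (α : ℝ)
    (θ : EuclideanSpace ℝ (Fin p)) : Set ℝ :=
  {σ | 0 < σ ∧ risk ρ H α θ σ ≤ b}

/-- `(α, θ)` solves the S-problem at `H`: the smallest (infimal) scale allowed by the constraint
at `(α, θ)` is minimal among all regression parameters. -/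
def IsSSolution {p : ℕ} (ρ : ℝ → ℝ) (b : ℝ) (H : Measure (Obs p)) (α : ℝ)
    (θ : EuclideanSpace ℝ (Fin p)) : Prop :=
  (feasibleScales ρ b H α θ).Nonempty ∧
    ∀ α' θ', (feasibleScales ρ b H α' θ').Nonempty →
      sInf (feasibleScales ρ b H α θ) ≤ sInf (feasibleScales ρ b H α' θ')

/-- The CM-objective `c E_H ρ((y - α - x'θ) / σ) + log σ`, minimized over the feasible scales. -/
def cmProfile {p : ℕ} (ρ : ℝ → ℝ) (b c : ℝ) (H : Measure (Obs p)) (α : ℝ)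
    (θ : EuclideanSpace ℝ (Fin p)) : ℝ :=
  sInf ((fun σ => c * risk ρ H α θ σ + Real.log σ) '' feasibleScales ρ b H α θ)

/-- `(α, θ)` solves the CM-problem at `H`. -/
def IsCMSolution {p : ℕ} (ρ : ℝ → ℝ) (b c : ℝ) (H : Measure (Obs p)) (α : ℝ)
    (θ : EuclideanSpace ℝ (Fin p)) : Prop :=
  (feasibleScales ρ b H α θ).Nonempty ∧
    ∀ α' θ', (feasibleScales ρ b H α' θ').Nonempty →
      cmProfile ρ b c H α θ ≤ cmProfile ρ b c H α' θ'

/-- The S-functional of scale `s(H)`: the least scale allowed by the constraint. -/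
def sScale {p : ℕ} (ρ : ℝ → ℝ) (b : ℝ) (H : Measure (Obs p)) : ℝ :=
  sInf {σ | ∃ α θ, σ ∈ feasibleScales ρ b H α θ}

/-- `(α, θ)` solves the MM-problem at `H`: it minimizes the `ρ₂`-risk at the preliminary
S-scale based on `ρ₁`. -/
def IsMMSolution {p : ℕ} (ρ₁ ρ₂ : ℝ → ℝ) (b : ℝ) (H : Measure (Obs p)) (α : ℝ)
    (θ : EuclideanSpace ℝ (Fin p)) : Prop :=
  ∀ α' θ', risk ρ₂ H α θ (sScale ρ₁ b H) ≤ risk ρ₂ H α' θ' (sScale ρ₁ b H)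

/-- `T` is (the slope part of) an S-estimate, defined on all of `V_ε`. -/
def IsSEstimate {p : ℕ} (ρ : ℝ → ℝ) (b ε : ℝ)
    (T : Measure (Obs p) → EuclideanSpace ℝ (Fin p)) : Prop :=
  ∀ H ∈ contamination p ε, ∃ α, IsSSolution ρ b H α (T H)

/-- `T` is (the slope part of) a CM-estimate, defined on all of `V_ε`. -/
def IsCMEstimate {p : ℕ} (ρ : ℝ → ℝ) (b c ε : ℝ)
    (T : Measure (Obs p) → EuclideanSpace ℝ (Fin p)) : Prop :=
  ∀ H ∈ contamination p ε, ∃ α, IsCMSolution ρ b c H α (T H)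

/-- `T` is (the slope part of) an MM-estimate, defined on all of `V_ε`. -/
def IsMMEstimate {p : ℕ} (ρ₁ ρ₂ : ℝ → ℝ) (b ε : ℝ)
    (T : Measure (Obs p) → EuclideanSpace ℝ (Fin p)) : Prop :=
  ∀ H ∈ contamination p ε, ∃ α, IsMMSolution ρ₁ ρ₂ b H α (T H)

/-- `g(s) = E ρ(Z / s)` for a standard Cauchy variable `Z`. -/
def g (ρ : ℝ → ℝ) (s : ℝ) : ℝ := ∫ z, ρ (z / s) ∂stdCauchy

/-- The inverse of the decreasing function `g` on `(0, ∞)`; it is `0` at values that are at least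
the supremum of `g`. -/
def gInv (ρ : ℝ → ℝ) (v : ℝ) : ℝ := sInf {s | 0 < s ∧ g ρ s ≤ v}

/-- `σ_{b,ε} = g⁻¹[(b - ε) / (1 - ε)]`. -/
def sigmaBE (ρ : ℝ → ℝ) (b ε : ℝ) : ℝ := gInv ρ ((b - ε) / (1 - ε))

/-- `γ_{b,ε} = g⁻¹[b / (1 - ε)]`. -/
def gammaBE (ρ : ℝ → ℝ) (b ε : ℝ) : ℝ := gInv ρ (b / (1 - ε))

/-- `A_{c,ε}(s) = c (1 - ε) g(s) + log s`. -/
def A (ρ : ℝ → ℝ) (c ε s : ℝ) : ℝ := c * (1 - ε) * g ρ s + Real.log s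

/-- `D_c(ε) = inf_{s ≥ σ_{b,ε}} A_{c,ε}(s) - inf_{s ≥ γ_{b,ε}} A_{c,ε}(s)`. -/
def D (ρ : ℝ → ℝ) (b c ε : ℝ) : ℝ :=
  sInf (A ρ c ε '' Set.Ici (sigmaBE ρ b ε)) - sInf (A ρ c ε '' Set.Ici (gammaBE ρ b ε))

/-- `m(t, s) = inf_{‖θ‖ = t} inf_α E_{H₀} ρ((y - α - x'θ) / s) - E_{H₀} ρ(y / s)`. -/
def mFun (p : ℕ) (ρ : ℝ → ℝ) (t s : ℝ) : ℝ :=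
  sInf {v | ∃ (θ : EuclideanSpace ℝ (Fin p)) (α : ℝ),
    ‖θ‖ = t ∧ v = risk ρ (cauchyModel p) α θ s} - risk ρ (cauchyModel p) 0 0 s

/-- The supremum over `V_ε` of the preliminary S-scale. -/
def sBar (p : ℕ) (ρ₁ : ℝ → ℝ) (b ε : ℝ) : ℝ := sSup (sScale ρ₁ b '' contamination p ε)

/-- `h₁(t) = m(t, s̄)`, with `m` based on `ρ₂`. -/
def h₁ (p : ℕ) (ρ₁ ρ₂ : ℝ → ℝ) (b ε t : ℝ) : ℝ := mFun p ρ₂ t (sBar p ρ₁ b ε)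

/-- The inverse of the increasing function `h₁` on `[0, ∞)`. -/
def h₁Inv (p : ℕ) (ρ₁ ρ₂ : ℝ → ℝ) (b ε v : ℝ) : ℝ :=
  sInf {t | 0 ≤ t ∧ v ≤ h₁ p ρ₁ ρ₂ b ε t}

/-- `φ(s) = -s g'(s)`. -/
def phi (ρ : ℝ → ℝ) (s : ℝ) : ℝ := -s * deriv (g ρ) s

/-- `g` is continuously differentiable on `(0, ∞)` and `φ` is unimodal there, with mode `σ_M`. -/
def GRegular (ρ : ℝ → ℝ) : Prop :=
  ContDiffOn ℝ 1 (g ρ) (Set.Ioi 0) ∧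
    ∃ σM : ℝ, 0 < σM ∧ MonotoneOn (phi ρ) (Set.Ioc 0 σM) ∧ AntitoneOn (phi ρ) (Set.Ici σM)

/-- `s / g₂⁻¹[g₂(s) + ε / (1 - ε)] - 1`, equal to `∞` when `g₂⁻¹[⋯] = 0`. -/
def biasExpr (ρ₂ : ℝ → ℝ) (ε s : ℝ) : ℝ≥0∞ :=
  ENNReal.ofReal s / ENNReal.ofReal (gInv ρ₂ (g ρ₂ s + ε / (1 - ε))) - 1

/-- The bound `ℓ(ε)`. -/
def lowerBd (ρ₁ ρ₂ : ℝ → ℝ) (b ε : ℝ) : ℝ≥0∞ := biasExpr ρ₂ ε (sigmaBE ρ₁ b ε)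

/-- The bound `u(ε)`. -/
def upperBd (ρ₁ ρ₂ : ℝ → ℝ) (b ε : ℝ) : ℝ≥0∞ := biasExpr ρ₂ ε (gammaBE ρ₁ b ε)

end CauchyRegression

end

open CauchyRegression

open CauchyRegression

namespace CauchyRegression
open Real FourierTransform Filter Topology

/-! Under the Cauchy model `y - x'θ` is a standard Cauchy variable times `1 + ∑ |θᵢ|`. An intercept
can only raise the expected loss, since the Cauchy density is symmetric and unimodal, and `∑ |θᵢ| ≥
‖θ‖` with equality on the coordinate axes. Hence the least model risk over slopes of norm `t` is `g
(s / (1 + t))`, and the problem becomes one-dimensional.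

Upper bounds compare `T H` with the zero fit: its risk is at most `(1 - ε) g s + ε`, while that of
`θ` is at least `(1 - ε) g (s / (1 + ‖θ‖))` (`risk_zero_le`, `g_le_risk`).

Lower bounds use contamination by a Cauchy multiple of `q = (n t, n eᵢ)`. The slope `t eᵢ` fits that
line exactly, so the contaminating part costs it nothing. A slope of norm at most `r < t` leaves
residuals of order `n` there, so its risk is nearly `(1 - ε) g s + ε` or more. Spreading the
contamination along a line, instead of using a point mass, prevents an intercept from absorbing it.
For `t` below the claimed bias, `t eᵢ` beats every slope of norm at most `r`.

For MM-estimates the preliminary scale lies in `[γ, σ]`. Unimodality of `φ` makes `g₂ (s / r) - g₂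
s` quasi-concave in `s`, so the upper bound need only be checked at the two endpoints. For the lower
bound, the assumption on the S-bias allows a slope large enough that one contamination both pushes
the scale close to `σ` and attracts the fit. -/

/-! ### Characteristic function of the Cauchy law and the law of the residuals. -/

theorem stdCauchy_eq_withDensity :
    stdCauchy = volume.withDensity (cauchyPDF 0 1) := by
  simp [stdCauchy, cauchyMeasure]

theorem integral_stdCauchy {E : Type*} [NormedAddCommGroup E] [NormedSpace ℝ E] (f : ℝ → E) :
    ∫ z, f z ∂stdCauchy = ∫ z, (π⁻¹ * (1 + z ^ 2)⁻¹) • f z := by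
  rw [stdCauchy_eq_withDensity,
    integral_withDensity_eq_integral_toReal_smul (measurable_cauchyPDF 0 1) (by simp [cauchyPDF])]
  refine integral_congr_ae (.of_forall fun z => ?_)
  simp only [cauchyPDF]
  rw [ENNReal.toReal_ofReal (cauchyPDF_pos 0 one_ne_zero z).le]
  simp [cauchyPDFReal, add_comm]

theorem integrable_cexp_neg_two_pi_abs :
    Integrable fun v : ℝ => Complex.exp (-(2 * π * |v| : ℝ)) := by
  have h : Integrable fun v : ℝ => rexp (-(2 * π * |v|)) := by
    rw [← integrableOn_univ, ← Set.Iic_union_Ioi (a := (0 : ℝ))]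
    refine IntegrableOn.union
      ((integrableOn_exp_mul_Iic (a := 2 * π) (by positivity) 0).congr_fun (fun v hv => ?_)
        measurableSet_Iic)
      ((integrableOn_exp_mul_Ioi (a := -(2 * π)) (by simp [pi_pos]) 0).congr_fun (fun v hv => ?_)
        measurableSet_Ioi)
    · simp [abs_of_nonpos (Set.mem_Iic.1 hv)]
    · simp [abs_of_pos (Set.mem_Ioi.1 hv)]
  simpa using h.ofReal (𝕜 := ℂ)

/-- Transforming the two-sided exponential needs only elementary integrals over two half-lines.
Fourier inversion then yields the Cauchy characteristic function without contour integration. -/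
theorem fourier_exp_neg_two_pi_abs (w : ℝ) :
    𝓕 (fun v : ℝ => Complex.exp (-(2 * π * |v| : ℝ))) w = ((π⁻¹ * (1 + w ^ 2)⁻¹ : ℝ) : ℂ) := by
  rw [Real.fourier_real_eq_integral_exp_smul]
  have hi : Integrable fun v : ℝ => Complex.exp (↑(-2 * π * v * w) * Complex.I) •
      Complex.exp (-(2 * π * |v| : ℝ)) := by
    refine integrable_cexp_neg_two_pi_abs.bdd_mul (c := 1) (by fun_prop) (.of_forall fun v => ?_)
    rw [Complex.norm_exp_ofReal_mul_I]
  rw [← integral_add_compl measurableSet_Iic (s := Set.Iic 0) hi, Set.compl_Iic]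
  have e1 : ∫ v in Set.Iic (0 : ℝ), Complex.exp (↑(-2 * π * v * w) * Complex.I) •
      Complex.exp (-(2 * π * |v| : ℝ)) =
      ∫ v in Set.Iic (0 : ℝ), Complex.exp ((2 * π * (1 - w * Complex.I)) * v) := by
    refine setIntegral_congr_fun measurableSet_Iic fun v hv => ?_
    simp only [smul_eq_mul, ← Complex.exp_add, abs_of_nonpos (Set.mem_Iic.1 hv)]
    congr 1; push_cast; ring
  have e2 : ∫ v in Set.Ioi (0 : ℝ), Complex.exp (↑(-2 * π * v * w) * Complex.I) •
      Complex.exp (-(2 * π * |v| : ℝ)) =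
      ∫ v in Set.Ioi (0 : ℝ), Complex.exp ((-(2 * π * (1 + w * Complex.I))) * v) := by
    refine setIntegral_congr_fun measurableSet_Ioi fun v hv => ?_
    simp only [smul_eq_mul, ← Complex.exp_add, abs_of_pos (Set.mem_Ioi.1 hv)]
    congr 1; push_cast; ring
  rw [e1, e2, integral_exp_mul_complex_Iic (by simp [pi_pos]), integral_exp_mul_complex_Ioi
    (by simp [pi_pos])]
  have hm : (1 - w * Complex.I) ≠ 0 := fun h => by simpa using congrArg Complex.re h
  have hp : (1 + w * Complex.I) ≠ 0 := fun h => by simpa using congrArg Complex.re h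
  have hw : (1 + (w : ℂ) ^ 2) = (1 - w * Complex.I) * (1 + w * Complex.I) := by
    ring_nf; simp
  have hπ : (π : ℂ) ≠ 0 := by exact_mod_cast pi_ne_zero
  push_cast
  rw [hw]
  simp only [mul_zero, Complex.exp_zero]
  field_simp
  ring

theorem charFun_stdCauchy (t : ℝ) : charFun stdCauchy t = Complex.exp (-(|t| : ℝ)) := by
  have hF : 𝓕 (fun v : ℝ => Complex.exp (-(2 * π * |v| : ℝ))) =
      fun w : ℝ => ((π⁻¹ * (1 + w ^ 2)⁻¹ : ℝ) : ℂ) := funext fourier_exp_neg_two_pi_abs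
  have hFi : Integrable (𝓕 (fun v : ℝ => Complex.exp (-(2 * π * |v| : ℝ)))) := by
    rw [hF]
    exact (integrable_inv_one_add_sq.const_mul _).ofReal
  have hc : Continuous fun v : ℝ => Complex.exp (-(2 * π * |v| : ℝ)) := by fun_prop
  -- The frequency is `t / (2π)` because the Fourier transform carries `2π` in its exponent and
  -- `charFun` does not.
  have key := congrFun (hc.fourierInv_fourier_eq integrable_cexp_neg_two_pi_abs hFi) (t / (2 * π))
  rw [hF, Real.fourierInv_eq_fourier_neg, Real.fourier_real_eq_integral_exp_smul] at key
  rw [charFun_apply_real, integral_stdCauchy]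
  have h2 : 2 * π * |t / (2 * π)| = |t| := by
    rw [abs_div, abs_of_pos (by positivity : 0 < 2 * π)]; field_simp
  rw [h2] at key
  rw [← key]
  refine integral_congr_ae (.of_forall fun z => ?_)
  simp only [smul_eq_mul, Complex.real_smul]
  rw [mul_comm]
  congr 2
  have hπ : (π : ℂ) ≠ 0 := by exact_mod_cast pi_ne_zero
  push_cast
  field_simp

instance (p : ℕ) : IsProbabilityMeasure
    ((Measure.pi fun _ : Fin p => stdCauchy).map (WithLp.toLp 2)) :=
  Measure.isProbabilityMeasure_map (by fun_prop)

instance (p : ℕ) : IsProbabilityMeasure (cauchyModel p) := by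
  unfold cauchyModel
  infer_instance

/-- Under the Cauchy model the residual `y - x'θ` is a standard Cauchy variable scaled by
`1 + ∑ |θᵢ|`. -/
theorem map_residual_cauchyModel {p : ℕ} (θ : EuclideanSpace ℝ (Fin p)) :
    (cauchyModel p).map (fun z => z.1 - inner ℝ z.2 θ) =
      stdCauchy.map (fun z => (1 + ∑ i, |θ i|) * z) := by
  have : IsProbabilityMeasure ((cauchyModel p).map (fun z => z.1 - inner ℝ z.2 θ)) :=
    Measure.isProbabilityMeasure_map (by fun_prop)
  have : IsProbabilityMeasure (stdCauchy.map (fun z => (1 + ∑ i, |θ i|) * z)) :=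
    Measure.isProbabilityMeasure_map (by fun_prop)
  refine Measure.ext_of_charFun (funext fun t => ?_)
  rw [charFun_map_mul, charFun_stdCauchy, charFun_apply_real,
    integral_map (by fun_prop) (by fun_prop), cauchyModel]
  have e : ∀ z : Obs p, Complex.exp (t * ↑(z.1 - inner ℝ z.2 θ) * Complex.I) =
      Complex.exp (t * z.1 * Complex.I) * Complex.exp (↑(inner ℝ z.2 (-t • θ)) * Complex.I) := by
    intro z
    rw [← Complex.exp_add, inner_smul_right]
    congr 1; push_cast; ring
  simp_rw [e]
  rw [integral_prod_mul (fun y : ℝ => Complex.exp (t * y * Complex.I))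
    (fun x : EuclideanSpace ℝ (Fin p) => Complex.exp (↑(inner ℝ x (-t • θ)) * Complex.I)),
    ← charFun_apply_real, ← charFun_apply, charFun_pi, charFun_stdCauchy]
  simp_rw [charFun_stdCauchy]
  rw [← Complex.exp_sum, ← Complex.exp_add]
  congr 1
  have h0 : 0 ≤ 1 + ∑ i, |θ i| := by positivity
  rw [abs_mul, abs_of_nonneg h0, add_mul, Finset.sum_mul]
  push_cast
  simp [abs_mul, mul_comm, add_comm]

/-! ### Elementary properties of loss functions. -/

namespace IsLoss

variable {ρ : ℝ → ℝ}

theorem le_of_abs_le (h : IsLoss ρ) {u v : ℝ} (huv : |u| ≤ |v|) : ρ u ≤ ρ v := by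
  have habs : ∀ w, ρ |w| = ρ w := fun w => by
    rcases abs_choice w with hw | hw <;> rw [hw]
    exact h.symm w
  rw [← habs u, ← habs v]
  exact h.monotoneOn (abs_nonneg u) (abs_nonneg v) huv

theorem nonneg (h : IsLoss ρ) (u : ℝ) : 0 ≤ ρ u := by
  rw [← h.map_zero]
  exact h.le_of_abs_le (by simp)

theorem le_one (h : IsLoss ρ) (u : ℝ) : ρ u ≤ 1 := by
  refine ge_of_tendsto h.tendsto_one ?_
  filter_upwards [eventually_ge_atTop |u|] with v hv
  exact h.le_of_abs_le (hv.trans (le_abs_self v))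

theorem norm_le_one (h : IsLoss ρ) (u : ℝ) : ‖ρ u‖ ≤ 1 := by
  rw [Real.norm_of_nonneg (h.nonneg u)]
  exact h.le_one u

theorem measurable (h : IsLoss ρ) : Measurable ρ := by
  have hm : Monotone fun x : ℝ => ρ (max x 0) := fun x y hxy =>
    h.monotoneOn (Set.mem_Ici.2 (le_max_right x 0)) (Set.mem_Ici.2 (le_max_right y 0))
      (max_le_max_right 0 hxy)
  have : ρ = (fun x : ℝ => ρ (max x 0)) ∘ fun u => |u| := by
    funext u
    simp only [Function.comp, max_eq_left (abs_nonneg u)]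
    exact le_antisymm (h.le_of_abs_le (by simp)) (h.le_of_abs_le (by simp))
  rw [this]
  exact hm.measurable.comp measurable_norm

theorem integrable_comp (h : IsLoss ρ) {X : Type*} [MeasurableSpace X] {μ : Measure X}
    [IsFiniteMeasure μ] {f : X → ℝ} (hf : Measurable f) : Integrable (fun x => ρ (f x)) μ :=
  .of_bound (h.measurable.comp hf).aestronglyMeasurable 1 (.of_forall fun _ => h.norm_le_one _)

theorem tendsto_one_of_abs (h : IsLoss ρ) {X : Type*} {l : Filter X} {f : X → ℝ}
    (hf : Tendsto (fun x => |f x|) l atTop) : Tendsto (fun x => ρ (f x)) l (𝓝 1) := by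
  refine (h.tendsto_one.comp hf).congr fun x => ?_
  exact le_antisymm (h.le_of_abs_le (by simp)) (h.le_of_abs_le (by simp))

end IsLoss

/-! ### The centring inequality and the function `g`. -/

/-- The Cauchy law puts the least expected loss at its centre of symmetry. -/
theorem integral_stdCauchy_le_integral_sub {r : ℝ → ℝ} (hr : Measurable r)
    (hb : ∀ u, ‖r u‖ ≤ 1) (hmono : ∀ u v, |u| ≤ |v| → r u ≤ r v) (a : ℝ) :
    ∫ z, r z ∂stdCauchy ≤ ∫ z, r (z - a) ∂stdCauchy := by
  have heq : ∀ u v, |u| = |v| → r u = r v := fun u v h =>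
    le_antisymm (hmono _ _ h.le) (hmono _ _ h.ge)
  set f : ℝ → ℝ := fun z => π⁻¹ * (1 + z ^ 2)⁻¹ with hf
  have hfi : Integrable f := integrable_inv_one_add_sq.const_mul _
  have i1 : Integrable fun z => f z * r z :=
    hfi.mul_bdd (c := 1) hr.aestronglyMeasurable (.of_forall hb)
  have i2 : Integrable fun z => f z * r (z - a) :=
    hfi.mul_bdd (c := 1) (hr.comp (measurable_id.sub_const a)).aestronglyMeasurable
      (.of_forall fun _ => hb _)
  have j1 := i1.comp_sub_left a
  have j2 := i2.comp_sub_left a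
  simp only [integral_stdCauchy, smul_eq_mul]
  have hI1 := integral_sub_left_eq_self (fun z => f z * r z) volume a
  have hI2 := integral_sub_left_eq_self (fun z => f z * r (z - a)) volume a
  -- Averaging with the reflection `z ↦ a - z` turns the integrand into `(f z - f (a - z)) * (r (z -
  -- a) - r z)`. Both factors have the sign of `|z - a| - |z|` or vanish.
  have hnn : 0 ≤ ∫ z, ((f z * r (z - a) - f z * r z) +
      (f (a - z) * r (a - z - a) - f (a - z) * r (a - z))) := by
    refine integral_nonneg fun z => ?_
    have e1 : r (a - z - a) = r z := heq _ _ (by rw [show a - z - a = -z by ring, abs_neg])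
    have e2 : r (a - z) = r (z - a) := heq _ _ (abs_sub_comm _ _)
    simp only [Pi.zero_apply]
    rw [e1, e2]
    have e3 : f z * r (z - a) - f z * r z + (f (a - z) * r z - f (a - z) * r (z - a)) =
      (f z - f (a - z)) * (r (z - a) - r z) := by ring
    rw [e3]
    have hfm : ∀ u v : ℝ, |u| ≤ |v| → f v ≤ f u := fun u v h => by
      have := sq_le_sq.2 h
      simp only [hf]
      gcongr
    rcases le_total |z| |z - a| with h | h
    · refine mul_nonneg (sub_nonneg.2 (hfm _ _ ?_)) (sub_nonneg.2 (hmono _ _ h))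
      rwa [abs_sub_comm a z]
    · refine mul_nonneg_of_nonpos_of_nonpos (sub_nonpos.2 (hfm _ _ ?_)) (sub_nonpos.2 (hmono _ _ h))
      rwa [abs_sub_comm a z]
  have e := integral_add (i2.sub i1) (j2.sub j1)
  simp only [Pi.sub_apply] at e
  rw [e, integral_sub i2 i1, integral_sub j2 j1] at hnn
  linarith

section

variable {ρ : ℝ → ℝ}

theorem IsLoss.g_div_le (h : IsLoss ρ) (k a s : ℝ) :
    g ρ (s / |k|) ≤ ∫ z, ρ ((k * z - a) / s) ∂stdCauchy := by
  have e : ∀ z, ρ (z / (s / |k|)) = ρ (k * z / s) := fun z => by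
    have : |z / (s / |k|)| = |k * z / s| := by
      rw [abs_div, abs_div, abs_abs, abs_div, abs_mul, div_div_eq_mul_div, mul_comm]
    exact le_antisymm (h.le_of_abs_le this.le) (h.le_of_abs_le this.ge)
  simp only [g, e]
  -- For `k = 0` the convention `x / 0 = 0` makes the left side `0`; otherwise the centring
  -- inequality applies with shift `a / k`.
  rcases eq_or_ne k 0 with rfl | hk
  · simp only [zero_mul, zero_div, h.map_zero, integral_zero]
    exact integral_nonneg fun _ => h.nonneg _
  · refine (integral_stdCauchy_le_integral_sub (r := fun z => ρ (k * z / s))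
      (h.measurable.comp (by fun_prop)) (fun _ => h.norm_le_one _)
      (fun u v huv => h.le_of_abs_le ?_) (a / k)).trans_eq ?_
    · simp only [abs_div, abs_mul]
      gcongr
    · simp only [mul_sub, mul_div_cancel₀ _ hk]

theorem IsLoss.g_le_one (h : IsLoss ρ) (s : ℝ) : g ρ s ≤ 1 := by
  have := integral_mono (μ := stdCauchy) (h.integrable_comp (by fun_prop : Measurable fun z => z / s))
    (integrable_const 1) fun z => h.le_one _
  simpa [g] using this

theorem IsLoss.g_nonneg (h : IsLoss ρ) (s : ℝ) : 0 ≤ g ρ s :=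
  integral_nonneg fun _ => h.nonneg _

theorem IsLoss.g_anti (h : IsLoss ρ) {s s' : ℝ} (hs : 0 < s) (hss : s ≤ s') :
    g ρ s' ≤ g ρ s := by
  refine integral_mono (h.integrable_comp (by fun_prop)) (h.integrable_comp (by fun_prop))
    fun z => h.le_of_abs_le ?_
  rw [abs_div, abs_div, abs_of_pos hs, abs_of_pos (hs.trans_le hss)]
  gcongr

theorem g_mono_loss {ρ' : ℝ → ℝ} (h : IsLoss ρ) (h' : IsLoss ρ') (hle : ∀ u, ρ u ≤ ρ' u) (s : ℝ) :
    g ρ s ≤ g ρ' s :=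
  integral_mono (h.integrable_comp (by fun_prop)) (h'.integrable_comp (by fun_prop))
    fun _ => hle _

theorem volume_absolutelyContinuous_stdCauchy : volume ≪ stdCauchy := by
  rw [stdCauchy_eq_withDensity]
  refine withDensity_absolutelyContinuous' (measurable_cauchyPDF 0 1).aemeasurable
    (.of_forall fun z => ?_)
  simpa [cauchyPDF] using cauchyPDF_pos 0 one_ne_zero z

theorem stdCauchy_absolutelyContinuous_volume : stdCauchy ≪ volume := by
  rw [stdCauchy_eq_withDensity]
  exact withDensity_absolutelyContinuous _ _

/-- The finitely many jumps of `ρ` pull back to a Cauchy-null set, so dominated convergence applies.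
-/
theorem IsLoss.continuousAt_g (h : IsLoss ρ) {s : ℝ} (hs : 0 < s) : ContinuousAt (g ρ) s := by
  refine continuousAt_of_dominated (bound := fun _ => 1)
    (.of_forall fun s => (h.measurable.comp (by fun_prop)).aestronglyMeasurable)
    (.of_forall fun s => .of_forall fun z => h.norm_le_one _) (integrable_const 1) ?_
  have hfin : {z | ¬ ContinuousAt ρ (z / s)}.Finite :=
    h.finite_discontinuities.preimage (f := fun z => z / s)
      fun x _ y _ hxy => by simpa [hs.ne', div_left_inj'] using hxy
  filter_upwards [stdCauchy_absolutelyContinuous_volume.ae_le (hfin.countable.ae_notMem volume)] with z hz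
  have hz : ContinuousAt ρ (z / s) := by simpa using hz
  exact ContinuousAt.comp (f := fun s => z / s) hz (continuousAt_const.div continuousAt_id hs.ne')

theorem IsLoss.tendsto_g (h : IsLoss ρ) : Tendsto (g ρ) (𝓝[>] 0) (𝓝 1) := by
  have : (1 : ℝ) = ∫ _, 1 ∂stdCauchy := by simp
  rw [this]
  refine tendsto_integral_filter_of_dominated_convergence (fun _ => 1)
    (.of_forall fun s => (h.measurable.comp (by fun_prop)).aestronglyMeasurable)
    (.of_forall fun s => .of_forall fun z => h.norm_le_one _) (integrable_const 1) ?_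
  filter_upwards [stdCauchy_absolutelyContinuous_volume.ae_le
    ((Set.countable_singleton (0 : ℝ)).ae_notMem volume)] with z hz
  refine h.tendsto_one_of_abs ?_
  simp only [div_eq_mul_inv, abs_mul, abs_inv]
  refine Tendsto.const_mul_atTop (abs_pos.2 (by simpa using hz)) ?_
  refine tendsto_inv_nhdsGT_zero.congr' ?_
  filter_upwards [self_mem_nhdsWithin] with s hs
  rw [abs_of_pos hs]

/-- Equality at `s < s'` would make `ρ` almost everywhere invariant under dilation by `q = s' / s >
1`. Iterating, `ρ z = ρ (q ^ n * z) → 1`, so `ρ = 1` almost everywhere and `g ρ s₀ = 1`, which `h1`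
excludes. -/
theorem IsLoss.g_strictAnti (h : IsLoss ρ) {s₀ : ℝ} (hs₀ : 0 < s₀) (h1 : g ρ s₀ < 1) {s s' : ℝ}
    (hs : 0 < s) (hss : s < s') : g ρ s' < g ρ s := by
  refine (h.g_anti hs hss.le).lt_of_ne fun heq => ?_
  have hs' := hs.trans hss
  have hae : ∀ᵐ z ∂stdCauchy, ρ (z / s') = ρ (z / s) := by
    have := (integral_eq_iff_of_ae_le (μ := stdCauchy) (f := fun z => ρ (z / s'))
      (g := fun z => ρ (z / s)) (h.integrable_comp (by fun_prop))
      (h.integrable_comp (by fun_prop)) (.of_forall fun z => h.le_of_abs_le ?_)).1 heq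
    · exact this
    · rw [abs_div, abs_div, abs_of_pos hs, abs_of_pos hs']
      gcongr
  have hvol := volume_absolutelyContinuous_stdCauchy.ae_le hae
  set q := s' / s with hq
  have hq1 : 1 < q := (one_lt_div hs).2 hss
  have hn : ∀ n : ℕ, ∀ᵐ z ∂(volume : Measure ℝ), ρ (q ^ n * z) = ρ (q ^ (n + 1) * z) := by
    intro n
    have hc : s' * q ^ n ≠ 0 := by positivity
    have hqmp : Measure.QuasiMeasurePreserving (fun z : ℝ => s' * q ^ n * z) volume volume := by
      refine ⟨by fun_prop, ?_⟩
      rw [Real.map_volume_mul_left hc]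
      exact Measure.smul_absolutelyContinuous
    filter_upwards [hqmp.ae hvol] with z hz
    convert hz using 2
    · field_simp
    · rw [pow_succ, hq]; field_simp
  have hone : ∀ᵐ z ∂(volume : Measure ℝ), ρ z = 1 := by
    filter_upwards [ae_all_iff.2 hn, (Set.countable_singleton (0 : ℝ)).ae_notMem volume]
      with z hz hz0
    have hc : ∀ n : ℕ, ρ (q ^ n * z) = ρ z := by
      intro n
      induction n with
      | zero => simp
      | succ n ih => rw [← hz n, ih]
    have ht : Tendsto (fun n : ℕ => ρ (q ^ n * z)) atTop (𝓝 1) := by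
      refine h.tendsto_one_of_abs ?_
      simp only [abs_mul, abs_pow, abs_of_pos (one_pos.trans hq1)]
      exact (tendsto_pow_atTop_atTop_of_one_lt hq1).atTop_mul_const (by simpa using hz0)
    simp only [hc] at ht
    exact tendsto_nhds_unique tendsto_const_nhds ht
  have hqmp : Measure.QuasiMeasurePreserving (fun z : ℝ => s₀⁻¹ * z) volume volume := by
    refine ⟨by fun_prop, ?_⟩
    rw [Real.map_volume_mul_left (inv_ne_zero hs₀.ne')]
    exact Measure.smul_absolutelyContinuous
  have h2 : ∀ᵐ z ∂stdCauchy, ρ (z / s₀) = 1 := by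
    refine stdCauchy_absolutelyContinuous_volume.ae_le ?_
    filter_upwards [hqmp.ae hone] with z hz
    rwa [div_eq_inv_mul]
  have : g ρ s₀ = 1 := by
    rw [g, integral_congr_ae h2]
    simp
  exact h1.ne this

end

/-! ### The generalized inverse of `g`. -/

section Inverse

variable {ρ : ℝ → ℝ} {v s : ℝ}

theorem gInv_le (hs : 0 < s) (hv : g ρ s ≤ v) : gInv ρ v ≤ s :=
  csInf_le ⟨0, fun _ h => h.1.le⟩ ⟨hs, hv⟩

theorem IsLoss.gInv_pos (h : IsLoss ρ) (hv : v < 1) (hne : ∃ s, 0 < s ∧ g ρ s ≤ v) :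
    0 < gInv ρ v := by
  obtain ⟨δ, hδ, hδ'⟩ := mem_nhdsGT_iff_exists_Ioo_subset.1 (h.tendsto_g.eventually_const_lt hv)
  refine (Set.mem_Ioi.1 hδ).trans_le (le_csInf hne fun s hs => ?_)
  by_contra! hlt
  exact (hδ' ⟨hs.1, hlt⟩ : v < g ρ s).not_ge hs.2

/-- Since `g → 1 > v` at `0`, the infimum is positive, hence a continuity point of `g`. The
one-sided limits there give the two inequalities. -/
theorem IsLoss.g_gInv (h : IsLoss ρ) (hv : v < 1) (hne : ∃ s, 0 < s ∧ g ρ s ≤ v) :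
    g ρ (gInv ρ v) = v := by
  have hpos := h.gInv_pos hv hne
  have hc := h.continuousAt_g hpos
  refine le_antisymm ?_ ?_
  · refine le_of_tendsto (hc.tendsto.mono_left (nhdsWithin_le_nhds (s := Set.Ioi (gInv ρ v)))) ?_
    filter_upwards [self_mem_nhdsWithin] with s hs
    obtain ⟨s', hs', hlt⟩ := exists_lt_of_csInf_lt (s := {s | 0 < s ∧ g ρ s ≤ v}) hne hs
    exact (h.g_anti hs'.1 hlt.le).trans hs'.2
  · refine ge_of_tendsto (hc.tendsto.mono_left (nhdsWithin_le_nhds (s := Set.Iio (gInv ρ v)))) ?_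
    filter_upwards [self_mem_nhdsWithin, nhdsWithin_le_nhds (Ioi_mem_nhds hpos)] with s hs hs0
    by_contra! hlt
    exact (gInv_le hs0 hlt.le).not_gt hs

end Inverse

/-! ### Risks under the model and under contamination along a line. -/

section Risk

variable {p : ℕ} {ρ : ℝ → ℝ} {ε : ℝ}

theorem IsLoss.risk_mixture (h : IsLoss ρ) (hε0 : 0 ≤ ε) (hε1 : ε ≤ 1) (Hs : Measure (Obs p))
    [IsProbabilityMeasure Hs] (α : ℝ) (θ : EuclideanSpace ℝ (Fin p)) (s : ℝ) :
    risk ρ (ENNReal.ofReal (1 - ε) • cauchyModel p + ENNReal.ofReal ε • Hs) α θ s =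
      (1 - ε) * risk ρ (cauchyModel p) α θ s + ε * risk ρ Hs α θ s := by
  have hm : Measurable fun z : Obs p => (z.1 - α - inner ℝ z.2 θ) / s := by fun_prop
  rw [risk, integral_add_measure ((h.integrable_comp hm).smul_measure ENNReal.ofReal_ne_top)
    ((h.integrable_comp hm).smul_measure ENNReal.ofReal_ne_top), integral_smul_measure,
    integral_smul_measure, ENNReal.toReal_ofReal (sub_nonneg.2 hε1), ENNReal.toReal_ofReal hε0]
  rfl

theorem IsLoss.risk_nonneg (h : IsLoss ρ) (H : Measure (Obs p)) (α : ℝ)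
    (θ : EuclideanSpace ℝ (Fin p)) (s : ℝ) : 0 ≤ risk ρ H α θ s :=
  integral_nonneg fun _ => h.nonneg _

theorem IsLoss.risk_le_one (h : IsLoss ρ) (H : Measure (Obs p)) [IsProbabilityMeasure H] (α : ℝ)
    (θ : EuclideanSpace ℝ (Fin p)) (s : ℝ) : risk ρ H α θ s ≤ 1 := by
  have := integral_mono (μ := H)
    (h.integrable_comp (by fun_prop : Measurable fun z : Obs p => (z.1 - α - inner ℝ z.2 θ) / s))
    (integrable_const 1) fun z => h.le_one _
  simpa [risk] using this

theorem IsLoss.risk_cauchyModel (h : IsLoss ρ) (α : ℝ) (θ : EuclideanSpace ℝ (Fin p)) (s : ℝ) :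
    risk ρ (cauchyModel p) α θ s = ∫ z, ρ (((1 + ∑ i, |θ i|) * z - α) / s) ∂stdCauchy := by
  have hm : Measurable fun w => ρ ((w - α) / s) := h.measurable.comp (by fun_prop)
  have e1 := integral_map (μ := cauchyModel p) (φ := fun z => z.1 - inner ℝ z.2 θ)
    (by fun_prop) hm.aestronglyMeasurable
  have e2 := integral_map (μ := stdCauchy) (φ := fun z => (1 + ∑ i, |θ i|) * z)
    (by fun_prop) hm.aestronglyMeasurable
  rw [← e2, ← map_residual_cauchyModel, e1, risk]
  simp only [sub_right_comm]

theorem norm_le_sum_abs (θ : EuclideanSpace ℝ (Fin p)) : ‖θ‖ ≤ ∑ i, |θ i| := by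
  rw [EuclideanSpace.norm_eq]
  refine Real.sqrt_le_iff.2 ⟨by positivity, ?_⟩
  simp only [Real.norm_eq_abs]
  exact Finset.sum_sq_le_sq_sum_of_nonneg fun i _ => abs_nonneg _

theorem IsLoss.g_le_risk_cauchyModel (h : IsLoss ρ) (α : ℝ) (θ : EuclideanSpace ℝ (Fin p)) {s : ℝ}
    (hs : 0 < s) : g ρ (s / (1 + ‖θ‖)) ≤ risk ρ (cauchyModel p) α θ s := by
  rw [h.risk_cauchyModel]
  have h1 : 0 < 1 + ∑ i, |θ i| := by positivity
  refine le_trans (h.g_anti (by positivity) ?_) (h.g_div_le _ α s)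
  rw [abs_of_pos h1]
  gcongr
  exact norm_le_sum_abs θ

/-- On a coordinate axis the `ℓ¹` and Euclidean norms agree, so the bound of `g_le_risk_cauchyModel`
is attained. -/
theorem IsLoss.risk_cauchyModel_single (h : IsLoss ρ) (i : Fin p) {t : ℝ} (ht : 0 ≤ t) (s : ℝ) :
    risk ρ (cauchyModel p) 0 (EuclideanSpace.single i t) s = g ρ (s / (1 + t)) := by
  have : ∑ j, |(EuclideanSpace.single i t : EuclideanSpace ℝ (Fin p)) j| = t := by
    rw [Finset.sum_eq_single i (fun j _ hj => by simp [hj]) (by simp)]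
    simp [abs_of_nonneg ht]
  rw [h.risk_cauchyModel, this, g]
  congr 1 with z
  rw [sub_zero, div_div_eq_mul_div, mul_comm]

theorem IsLoss.risk_cauchyModel_zero (h : IsLoss ρ) (s : ℝ) :
    risk ρ (cauchyModel p) 0 0 s = g ρ s := by
  simp [h.risk_cauchyModel, g]

/-- The law of `W • q` for a standard Cauchy variable `W`. -/
noncomputable def lineLaw (q : Obs p) : Measure (Obs p) := stdCauchy.map fun w => w • q

instance (q : Obs p) : IsProbabilityMeasure (lineLaw q) :=
  Measure.isProbabilityMeasure_map (by fun_prop)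

theorem IsLoss.risk_lineLaw (h : IsLoss ρ) (q : Obs p) (α : ℝ) (θ : EuclideanSpace ℝ (Fin p))
    (s : ℝ) : risk ρ (lineLaw q) α θ s =
      ∫ z, ρ (((q.1 - inner ℝ q.2 θ) * z - α) / s) ∂stdCauchy := by
  have hm : Measurable fun z : Obs p => ρ ((z.1 - α - inner ℝ z.2 θ) / s) :=
    h.measurable.comp (by fun_prop)
  rw [risk, lineLaw, integral_map (by fun_prop) hm.aestronglyMeasurable]
  congr 1 with w
  congr 2
  simp only [Prod.smul_fst, Prod.smul_snd, inner_smul_left, smul_eq_mul]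
  simp
  ring

/-- The Cauchy model contaminated along the line through `q`. -/
noncomputable def lineContamination (ε : ℝ) (q : Obs p) : Measure (Obs p) :=
  ENNReal.ofReal (1 - ε) • cauchyModel p + ENNReal.ofReal ε • lineLaw q

theorem lineContamination_mem (q : Obs p) : lineContamination ε q ∈ contamination p ε :=
  ⟨lineLaw q, inferInstance, rfl⟩

variable (hε0 : 0 ≤ ε) (hε1 : ε ≤ 1)
include hε0 hε1

theorem IsLoss.g_le_risk (h : IsLoss ρ) {H : Measure (Obs p)} (hH : H ∈ contamination p ε)
    (α : ℝ) (θ : EuclideanSpace ℝ (Fin p)) {s : ℝ} (hs : 0 < s) :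
    (1 - ε) * g ρ (s / (1 + ‖θ‖)) ≤ risk ρ H α θ s := by
  obtain ⟨Hs, _, rfl⟩ := hH
  rw [h.risk_mixture hε0 hε1]
  have h1 := mul_le_mul_of_nonneg_left (h.g_le_risk_cauchyModel α θ hs) (sub_nonneg.2 hε1)
  have h2 := mul_nonneg hε0 (h.risk_nonneg Hs α θ s)
  linarith

theorem IsLoss.risk_zero_le (h : IsLoss ρ) {H : Measure (Obs p)} (hH : H ∈ contamination p ε)
    (s : ℝ) : risk ρ H 0 0 s ≤ (1 - ε) * g ρ s + ε := by
  obtain ⟨Hs, _, rfl⟩ := hH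
  rw [h.risk_mixture hε0 hε1, h.risk_cauchyModel_zero]
  have h2 := mul_le_mul_of_nonneg_left (h.risk_le_one Hs 0 0 s) hε0
  linarith

/-- The slope `t eᵢ` annihilates every point of the line, so the contaminating part contributes `ρ 0
= 0`. -/
theorem IsLoss.risk_lineContamination_single (h : IsLoss ρ) (i : Fin p) {t : ℝ} (ht : 0 ≤ t)
    (n s : ℝ) :
    risk ρ (lineContamination ε (n * t, EuclideanSpace.single i n)) 0
      (EuclideanSpace.single i t) s = (1 - ε) * g ρ (s / (1 + t)) := by
  rw [lineContamination, h.risk_mixture hε0 hε1, h.risk_cauchyModel_single i ht, h.risk_lineLaw]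
  simp [EuclideanSpace.inner_single_left, h.map_zero]

/-- Contamination far along a line forces the contaminated part of the risk towards its maximum,
unless the fit follows the line. -/
theorem IsLoss.exists_forall_le_risk_lineContamination (h : IsLoss ρ) {S v : ℝ} (hS : 0 < S)
    (hv : v < 1) : ∃ N, ∀ (q : Obs p) (α : ℝ) (θ : EuclideanSpace ℝ (Fin p)),
      N ≤ |q.1 - inner ℝ q.2 θ| → ∀ s, 0 < s → s ≤ S →
        (1 - ε) * g ρ s + ε * v ≤ risk ρ (lineContamination ε q) α θ s := by
  obtain ⟨δ, hδ, hδ'⟩ := mem_nhdsGT_iff_exists_Ioo_subset.1 (h.tendsto_g.eventually_const_lt hv)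
  have hδ : 0 < δ := hδ
  -- This bound forces `s / |k| ≤ δ / 2 < δ` for all `s ≤ S`, where `k` is the residual of `q`. It
  -- does not depend on `α`, thanks to the centring inequality.
  refine ⟨S / (δ / 2), fun q α θ hN s hs hsS => ?_⟩
  have hk : 0 < |q.1 - inner ℝ q.2 θ| := lt_of_lt_of_le (by positivity) hN
  have hlt : s / |q.1 - inner ℝ q.2 θ| < δ := by
    rw [div_le_iff₀ (by positivity)] at hN
    rw [div_lt_iff₀ hk]
    nlinarith
  have h1 : v < g ρ (s / |q.1 - inner ℝ q.2 θ|) := hδ' ⟨by positivity, hlt⟩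
  have h2 := h.g_div_le (q.1 - inner ℝ q.2 θ) α s
  rw [← h.risk_lineLaw q α θ s] at h2
  have h3 := h.g_le_risk_cauchyModel α θ hs
  have h4 : g ρ s ≤ g ρ (s / (1 + ‖θ‖)) :=
    h.g_anti (by positivity) (div_le_self hs.le (by simp))
  rw [lineContamination, h.risk_mixture hε0 hε1]
  have h5 := mul_le_mul_of_nonneg_left (h4.trans h3) (sub_nonneg.2 hε1)
  have h6 := mul_le_mul_of_nonneg_left (h1.le.trans h2) hε0
  linarith

end Risk

/-- The `i`-th coordinate of `θ` is at most `r`, so the residual is at least `n (t - r)`. -/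
theorem exists_le_abs_mul_sub_inner {p : ℕ} (i : Fin p) (N : ℝ) {r t : ℝ} (hrt : r < t) :
    ∃ n₀, ∀ n, n₀ ≤ n → ∀ θ : EuclideanSpace ℝ (Fin p), ‖θ‖ ≤ r →
      N ≤ |n * t - inner ℝ (EuclideanSpace.single i n) θ| := by
  refine ⟨max 0 (N / (t - r)), fun n hn θ hθ => ?_⟩
  have hd : 0 < t - r := sub_pos.2 hrt
  have hn0 : 0 ≤ n := (le_max_left _ _).trans hn
  have hn1 : N ≤ n * (t - r) := (div_le_iff₀ hd).1 ((le_max_right _ _).trans hn)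
  have hi : θ i ≤ r := (le_abs_self _).trans ((PiLp.norm_apply_le θ i).trans hθ)
  rw [EuclideanSpace.inner_single_left]
  refine le_trans ?_ (le_abs_self _)
  simp only [conj_trivial]
  nlinarith

/-- Common frame of the lower bounds: the gap between `r` and `t` leaves room to send the
contamination far away from all slopes of norm at most `r`. -/
theorem ofReal_le_maxBias {p : ℕ} {T : Measure (Obs p) → EuclideanSpace ℝ (Fin p)} {ε x : ℝ}
    (h : ∀ r t, 0 ≤ r → r < t → t < x → ∃ H ∈ contamination p ε, r < ‖T H‖) :
    ENNReal.ofReal x ≤ maxBias T ε := by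
  by_contra! hlt
  obtain ⟨r, hr0, hr, hrx⟩ := ENNReal.lt_iff_exists_real_btwn.1 hlt
  obtain ⟨t, hrt, htx⟩ := exists_between ((ENNReal.ofReal_lt_ofReal_iff' .. ).1 hrx).1
  obtain ⟨H, hH, hT⟩ := h r t hr0 hrt htx
  refine hr.not_ge ((ENNReal.ofReal_le_ofReal hT.le).trans ?_)
  exact le_iSup₂ (f := fun H _ => ENNReal.ofReal ‖T H‖) H hH

/-- The contaminating risk only approaches `1`; a strict inequality valid at `1` survives at some `v
< 1`. -/
theorem exists_lt_one_lt_add_mul {x y k : ℝ} (h : y < x + k) : ∃ v < 1, y < x + k * v := by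
  have hc : ContinuousAt (fun v => x + k * v) 1 := by fun_prop
  have := (hc.tendsto.mono_left (nhdsWithin_le_nhds (s := Set.Iio 1))).eventually_const_lt
    (u := y) (by simpa using h)
  obtain ⟨v, hv, hv1⟩ := (this.and self_mem_nhdsWithin).exists
  exact ⟨v, hv1, hv⟩

/-! ### Critical scales, S-estimates and CM-estimates. -/

section

variable {p : ℕ} {ρ : ℝ → ℝ} {b ε : ℝ}

theorem bddBelow_feasibleScales (H : Measure (Obs p)) (α : ℝ) (θ : EuclideanSpace ℝ (Fin p)) :
    BddBelow (feasibleScales ρ b H α θ) := ⟨0, fun _ h => h.1.le⟩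

/-- The facts about the two critical scales `σ = σ_{b,ε}` and `γ = γ_{b,ε}` used below. -/
structure CriticalScales (ρ : ℝ → ℝ) (b ε σ γ : ℝ) : Prop where
  isLoss : IsLoss ρ
  ε_pos : 0 < ε
  ε_lt_one : ε < 1
  σ_pos : 0 < σ
  γ_pos : 0 < γ
  σ_spec : (1 - ε) * g ρ σ + ε = b
  γ_spec : (1 - ε) * g ρ γ = b
  σ_le : ∀ s, 0 < s → (1 - ε) * g ρ s + ε ≤ b → σ ≤ s
  γ_le : ∀ s, 0 < s → (1 - ε) * g ρ s ≤ b → γ ≤ s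

theorem criticalScales (h : IsLoss ρ) (hε : 0 < ε) (hεb : ε < min b (1 - b))
    (hv : ∃ s, 0 < s ∧ g ρ s = (b - ε) / (1 - ε)) :
    CriticalScales ρ b ε (sigmaBE ρ b ε) (gammaBE ρ b ε) := by
  obtain ⟨h1, h2⟩ := lt_min_iff.1 hεb
  have hε1 : 0 < 1 - ε := by linarith
  have hσ1 : (b - ε) / (1 - ε) < 1 := (div_lt_one hε1).2 (by linarith)
  have hγ1 : b / (1 - ε) < 1 := (div_lt_one hε1).2 (by linarith)
  obtain ⟨s, hs, hgs⟩ := hv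
  have hσn : ∃ s, 0 < s ∧ g ρ s ≤ (b - ε) / (1 - ε) := ⟨s, hs, hgs.le⟩
  have hγn : ∃ s, 0 < s ∧ g ρ s ≤ b / (1 - ε) :=
    ⟨s, hs, hgs.le.trans (by gcongr; linarith)⟩
  refine ⟨h, hε, by linarith, h.gInv_pos hσ1 hσn, h.gInv_pos hγ1 hγn, ?_, ?_, ?_, ?_⟩
  · rw [sigmaBE, h.g_gInv hσ1 hσn]; field_simp; ring
  · rw [gammaBE, h.g_gInv hγ1 hγn]; field_simp
  · intro s hs hle
    exact gInv_le hs ((le_div_iff₀ hε1).2 (by linarith))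
  · intro s hs hle
    exact gInv_le hs ((le_div_iff₀ hε1).2 (by linarith))

namespace CriticalScales

variable {σ γ : ℝ} (C : CriticalScales ρ b ε σ γ)
include C

theorem lt_of_lt_σ {s : ℝ} (hs : 0 < s) (h : s < σ) : b < (1 - ε) * g ρ s + ε := by
  by_contra! hle
  exact (C.σ_le s hs hle).not_gt h

theorem feasible_zero {H : Measure (Obs p)} (hH : H ∈ contamination p ε) {s : ℝ} (hs : σ ≤ s) :
    s ∈ feasibleScales ρ b H 0 0 := by
  refine ⟨C.σ_pos.trans_le hs, (C.isLoss.risk_zero_le C.ε_pos.le C.ε_lt_one.le hH s).trans ?_⟩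
  rw [← C.σ_spec]
  have h1 : 0 ≤ 1 - ε := sub_nonneg.2 C.ε_lt_one.le
  gcongr
  exact C.isLoss.g_anti C.σ_pos hs

theorem le_div_of_feasible {H : Measure (Obs p)} (hH : H ∈ contamination p ε) {α : ℝ}
    {θ : EuclideanSpace ℝ (Fin p)} {s : ℝ} (hs : s ∈ feasibleScales ρ b H α θ) :
    γ ≤ s / (1 + ‖θ‖) := by
  have := hs.1
  exact C.γ_le _ (by positivity) ((C.isLoss.g_le_risk C.ε_pos.le C.ε_lt_one.le hH α θ hs.1).trans
    hs.2)

theorem le_of_feasible {H : Measure (Obs p)} (hH : H ∈ contamination p ε) {α : ℝ}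
    {θ : EuclideanSpace ℝ (Fin p)} {s : ℝ} (hs : s ∈ feasibleScales ρ b H α θ) :
    γ * (1 + ‖θ‖) ≤ s :=
  (le_div_iff₀ (by positivity)).1 (C.le_div_of_feasible hH hs)

theorem feasible_single (i : Fin p) {t : ℝ} (ht : 0 ≤ t) (n : ℝ) {s : ℝ} (hs : γ ≤ s) :
    s * (1 + t) ∈ feasibleScales ρ b (lineContamination ε (n * t, EuclideanSpace.single i n)) 0
      (EuclideanSpace.single i t) := by
  have hs0 := C.γ_pos.trans_le hs
  refine ⟨by positivity, ?_⟩
  rw [C.isLoss.risk_lineContamination_single C.ε_pos.le C.ε_lt_one.le i ht,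
    mul_div_cancel_right₀ _ (by positivity), ← C.γ_spec]
  have h1 : 0 ≤ 1 - ε := sub_nonneg.2 C.ε_lt_one.le
  gcongr
  exact C.isLoss.g_anti C.γ_pos hs

theorem maxBias_S (i : Fin p) {T : Measure (Obs p) → EuclideanSpace ℝ (Fin p)}
    (hT : IsSEstimate ρ b ε T) : maxBias T ε = ENNReal.ofReal (σ / γ - 1) := by
  have hε1 : 0 < 1 - ε := sub_pos.2 C.ε_lt_one
  refine le_antisymm (iSup₂_le fun H hH => ENNReal.ofReal_le_ofReal ?_)
    (ofReal_le_maxBias fun r t hr hrt htx => ?_)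
  · obtain ⟨α, hne, hmin⟩ := hT H hH
    have h1 : sInf (feasibleScales ρ b H 0 0) ≤ σ :=
      csInf_le (bddBelow_feasibleScales ..) (C.feasible_zero hH le_rfl)
    have h2 : γ * (1 + ‖T H‖) ≤ sInf (feasibleScales ρ b H α (T H)) :=
      le_csInf hne fun s hs => C.le_of_feasible hH hs
    have h3 := hmin 0 0 ⟨σ, C.feasible_zero hH le_rfl⟩
    have := (le_div_iff₀' C.γ_pos).2 (h2.trans (h3.trans h1))
    linarith
  · have ht : 0 ≤ t := hr.trans hrt.le
    have hγt : γ * (1 + t) < σ := (lt_div_iff₀' C.γ_pos).1 (by linarith)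
    -- `S` separates the scale `γ (1 + t)`, feasible at `t eᵢ`, from the scales near `σ` that any
    -- slope of norm at most `r` will need.
    obtain ⟨S, hS, hSσ⟩ := exists_between hγt
    have hγt0 : 0 < γ * (1 + t) := mul_pos C.γ_pos (by linarith)
    have hS0 : 0 < S := hγt0.trans hS
    obtain ⟨v, hv, hvb⟩ := exists_lt_one_lt_add_mul (C.lt_of_lt_σ hS0 hSσ)
    obtain ⟨N, hN⟩ := C.isLoss.exists_forall_le_risk_lineContamination (p := p) C.ε_pos.le
      C.ε_lt_one.le hS0 hv
    obtain ⟨n, hn⟩ := exists_le_abs_mul_sub_inner i N hrt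
    refine ⟨_, lineContamination_mem (n * t, EuclideanSpace.single i n), ?_⟩
    by_contra! hle
    obtain ⟨α, hne, hmin⟩ := hT _ (lineContamination_mem (n * t, EuclideanSpace.single i n))
    have hf := C.feasible_single i ht n le_rfl
    have h1 := (hmin _ _ ⟨_, hf⟩).trans (csInf_le (bddBelow_feasibleScales ..) hf)
    obtain ⟨s, hs, hsS⟩ := exists_lt_of_csInf_lt hne (h1.trans_lt hS)
    have h2 := (hN (n * t, EuclideanSpace.single i n) α _ (hn n le_rfl _ hle) s hs.1 hsS.le).trans hs.2
    have h3 := mul_le_mul_of_nonneg_left (C.isLoss.g_anti hs.1 hsS.le) hε1.le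
    linarith

theorem bddBelow_A {c a : ℝ} (hc : 0 < c) (ha : 0 < a) : BddBelow (A ρ c ε '' Set.Ici a) := by
  refine ⟨log a, ?_⟩
  rintro _ ⟨s, hs, rfl⟩
  have hε1 : 0 ≤ 1 - ε := sub_nonneg.2 C.ε_lt_one.le
  have h1 : 0 ≤ c * (1 - ε) * g ρ s := mul_nonneg (by positivity) (C.isLoss.g_nonneg s)
  have h2 := log_le_log ha (Set.mem_Ici.1 hs)
  simp only [A]
  linarith

theorem bddBelow_cmValues {c : ℝ} (hc : 0 < c) {H : Measure (Obs p)}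
    (hH : H ∈ contamination p ε) (α : ℝ) (θ : EuclideanSpace ℝ (Fin p)) :
    BddBelow ((fun s => c * risk ρ H α θ s + log s) '' feasibleScales ρ b H α θ) := by
  refine ⟨log γ, ?_⟩
  rintro _ ⟨s, hs, rfl⟩
  have h1 : 0 ≤ c * risk ρ H α θ s := mul_nonneg hc.le (C.isLoss.risk_nonneg ..)
  have h2 : γ ≤ s := (le_mul_of_one_le_right C.γ_pos.le (by simp)).trans (C.le_of_feasible hH hs)
  have h3 := log_le_log C.γ_pos h2
  simp only
  linarith

theorem maxBias_CM (i : Fin p) {c : ℝ} (hc : 0 < c)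
    {T : Measure (Obs p) → EuclideanSpace ℝ (Fin p)} (hT : IsCMEstimate ρ b c ε T) :
    maxBias T ε = ENNReal.ofReal (exp (sInf (A ρ c ε '' Set.Ici σ) -
      sInf (A ρ c ε '' Set.Ici γ) + c * ε) - 1) := by
  have hε1 : 0 < 1 - ε := sub_pos.2 C.ε_lt_one
  set Iσ := sInf (A ρ c ε '' Set.Ici σ) with hIσ
  set Iγ := sInf (A ρ c ε '' Set.Ici γ) with hIγ
  refine le_antisymm (iSup₂_le fun H hH => ENNReal.ofReal_le_ofReal ?_)
    (ofReal_le_maxBias fun r t hr hrt htx => ?_)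
  · obtain ⟨α, hne, hmin⟩ := hT H hH
    have h1 : cmProfile ρ b c H 0 0 - c * ε ≤ Iσ := by
      refine le_csInf (Set.nonempty_Ici.image _) ?_
      rintro _ ⟨s, hs, rfl⟩
      have hf := C.feasible_zero hH hs
      have h2 := csInf_le (C.bddBelow_cmValues hc hH 0 0) (Set.mem_image_of_mem _ hf)
      have h3 := mul_le_mul_of_nonneg_left
        (C.isLoss.risk_zero_le C.ε_pos.le C.ε_lt_one.le hH s) hc.le
      simp only [cmProfile, A] at h2 ⊢
      linarith
    -- With `s = s' (1 + ‖T H‖)` one has `s' ≥ γ`, and the objective is at least `A s' + log (1 + ‖T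
    -- H‖)`.
    have h2 : Iγ + log (1 + ‖T H‖) ≤ cmProfile ρ b c H α (T H) := by
      refine le_csInf (hne.image _) ?_
      rintro _ ⟨s, hs, rfl⟩
      have h3 := csInf_le (C.bddBelow_A hc C.γ_pos)
        (Set.mem_image_of_mem (A ρ c ε) (C.le_div_of_feasible hH hs))
      have h4 := mul_le_mul_of_nonneg_left
        (C.isLoss.g_le_risk C.ε_pos.le C.ε_lt_one.le hH α (T H) hs.1) hc.le
      rw [A, log_div hs.1.ne' (by positivity)] at h3
      simp only
      linarith
    have h3 := hmin 0 0 ⟨σ, C.feasible_zero hH le_rfl⟩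
    have h4 : log (1 + ‖T H‖) ≤ Iσ - Iγ + c * ε := by linarith
    have h5 := (log_le_iff_le_exp (by positivity)).1 h4
    linarith
  · have ht : 0 ≤ t := hr.trans hrt.le
    have hlog : Iγ + log (1 + t) < Iσ + c * ε := by
      have := (log_lt_iff_lt_exp (by linarith : 0 < 1 + t)).2 (by linarith)
      linarith
    obtain ⟨P, hP, hPσ⟩ := exists_between hlog
    obtain ⟨P', hPP', hP'⟩ := exists_between hPσ
    -- Finite contamination excludes only scales below some `σ' < σ`, so the lower bound on `A` is
    -- first extended slightly to the left of `σ` by continuity.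
    obtain ⟨σ', hσ', hσ'σ, hAσ'⟩ : ∃ σ', 0 < σ' ∧ σ' < σ ∧
        ∀ s, σ' ≤ s → P' < A ρ c ε s + c * ε := by
      have hcont : ContinuousAt (fun s => A ρ c ε s + c * ε) σ :=
        ((continuousAt_const.mul (C.isLoss.continuousAt_g C.σ_pos)).add
          (continuousAt_log C.σ_pos.ne')).add continuousAt_const
      have hle : ∀ s, σ ≤ s → Iσ ≤ A ρ c ε s := fun s hs =>
        csInf_le (C.bddBelow_A hc C.σ_pos) (Set.mem_image_of_mem (A ρ c ε) hs)
      have hev := (hcont.tendsto.eventually_const_lt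
        (show P' < _ by have := hle σ le_rfl; linarith)).and (Ioi_mem_nhds C.σ_pos)
      obtain ⟨l, hl, hl'⟩ := exists_Ioc_subset_of_mem_nhds hev ⟨0, C.σ_pos⟩
      obtain ⟨σ', h1, h2⟩ := exists_between hl
      refine ⟨σ', (hl' ⟨h1, h2.le⟩).2, h2, fun s hs => ?_⟩
      rcases le_total σ s with h | h
      · linarith [hle s h]
      · exact (hl' ⟨h1.trans_le hs, h⟩).1
    -- `v₁` makes scales up to `σ'` infeasible; `v₂` keeps the objective above `P` on the remaining
    -- ones.
    obtain ⟨v₁, hv₁, hvb₁⟩ := exists_lt_one_lt_add_mul (C.lt_of_lt_σ hσ' hσ'σ)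
    obtain ⟨v₂, hv₂, hvb₂⟩ := exists_lt_one_lt_add_mul
      (show P < (P' - c * ε) + c * ε by linarith)
    have hv : max v₁ v₂ < 1 := max_lt hv₁ hv₂
    obtain ⟨N, hN⟩ := C.isLoss.exists_forall_le_risk_lineContamination (p := p) C.ε_pos.le
      C.ε_lt_one.le (exp_pos P) hv
    obtain ⟨n, hn⟩ := exists_le_abs_mul_sub_inner i N hrt
    have hH := lineContamination_mem (ε := ε) (n * t, EuclideanSpace.single i n)
    refine ⟨_, hH, ?_⟩
    by_contra! hle
    obtain ⟨α, hne, hmin⟩ := hT _ hH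
    have h1 : cmProfile ρ b c (lineContamination ε (n * t, EuclideanSpace.single i n)) 0
        (EuclideanSpace.single i t) - log (1 + t) ≤ Iγ := by
      refine le_csInf (Set.nonempty_Ici.image _) ?_
      rintro _ ⟨s, hs, rfl⟩
      have hs0 := C.γ_pos.trans_le (Set.mem_Ici.1 hs)
      have h2 := csInf_le (C.bddBelow_cmValues hc hH _ _)
        (Set.mem_image_of_mem _ (C.feasible_single i ht n hs))
      rw [C.isLoss.risk_lineContamination_single C.ε_pos.le C.ε_lt_one.le i ht,
        mul_div_cancel_right₀ _ (by positivity), log_mul hs0.ne' (by positivity)] at h2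
      simp only [cmProfile, A]
      linarith
    have h2 := hmin _ _ ⟨_, C.feasible_single i ht n le_rfl⟩
    obtain ⟨_, ⟨s, hs, rfl⟩, hsP⟩ := exists_lt_of_csInf_lt (hne.image _)
      (show cmProfile ρ b c _ α _ < P by linarith)
    simp only at hsP
    -- The loss term is nonnegative, so an objective below `P` bounds the scale by `exp P`; this is
    -- why `N` was chosen for scales up to `exp P`.
    have h3 : s ≤ exp P := by
      refine (log_le_iff_le_exp hs.1).1 ?_
      have := mul_nonneg hc.le (C.isLoss.risk_nonneg
        (lineContamination ε (n * t, EuclideanSpace.single i n)) α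
        (T (lineContamination ε (n * t, EuclideanSpace.single i n))) s)
      linarith
    have h4 := hN (n * t, EuclideanSpace.single i n) α _ (hn n le_rfl _ hle) s hs.1 h3
    have h5 := mul_le_mul_of_nonneg_left (le_max_left v₁ v₂) C.ε_pos.le
    have h6 := mul_le_mul_of_nonneg_left (le_max_right v₁ v₂) (mul_pos hc C.ε_pos).le
    rcases le_total σ' s with h | h
    · have h7 := hAσ' s h
      have h8 := mul_le_mul_of_nonneg_left h4 hc.le
      rw [A] at h7
      linarith
    · have h7 := mul_le_mul_of_nonneg_left (C.isLoss.g_anti hs.1 h) hε1.le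
      have h8 := hs.2
      linarith

end CriticalScales

end

/-! ### Quasi-concavity of the increments of `g`. -/

/-- For a unimodal `φ = -s g'(s)`, the increment `g (s / r) - g s` is a quasi-concave function of
`s`. -/
theorem GRegular.le_sub_of_le {ρ : ℝ → ℝ} (h : GRegular ρ) {r v s₁ s s₂ : ℝ} (hr : 1 ≤ r)
    (h0 : 0 < s₁) (h1 : s₁ ≤ s) (h2 : s ≤ s₂) (hv1 : v ≤ g ρ (s₁ / r) - g ρ s₁)
    (hv2 : v ≤ g ρ (s₂ / r) - g ρ s₂) : v ≤ g ρ (s / r) - g ρ s := by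
  obtain ⟨hC, σM, hσM, hmono, hanti⟩ := h
  have hr0 : 0 < r := one_pos.trans_le hr
  have hder : ∀ x, 0 < x → HasDerivAt (g ρ) (deriv (g ρ) x) x := fun x hx =>
    ((hC.differentiableOn one_ne_zero).differentiableAt (Ioi_mem_nhds hx)).hasDerivAt
  have hF : ∀ x, 0 < x → HasDerivAt (fun x => g ρ (x / r) - g ρ x)
      ((phi ρ x - phi ρ (x / r)) / x) x := by
    intro x hx
    have hd := ((hder (x / r) (by positivity)).comp x ((hasDerivAt_id x).div_const r)).sub
      (hder x hx)
    refine hd.congr_deriv ?_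
    simp only [phi]
    field_simp
    ring
  have hle : ∀ x, 0 < x → x / r ≤ x := fun x hx => div_le_self hx.le hr
  -- Once the derivative is negative it stays nonpositive. A drop from `x / r` to `x` puts `x`
  -- beyond the mode. If `y / r` is also beyond it, `φ` decreases from `y / r` to `y`; otherwise `φ
  -- y ≤ φ x < φ (x / r) ≤ φ (y / r)`.
  have hsign : ∀ x y, 0 < x → x ≤ y → phi ρ x < phi ρ (x / r) → phi ρ y ≤ phi ρ (y / r) := by
    intro x y hx hxy hlt
    have hy := hx.trans_le hxy
    have hxM : σM < x := by
      by_contra! hxM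
      exact hlt.not_ge (hmono ⟨by positivity, (hle x hx).trans hxM⟩ ⟨hx, hxM⟩ (hle x hx))
    have hyM : σM < y := hxM.trans_le hxy
    rcases le_total σM (y / r) with hM | hM
    · exact hanti (Set.mem_Ici.2 hM) (Set.mem_Ici.2 hyM.le) (hle y hy)
    · have hxyr : x / r ≤ y / r := by gcongr
      exact (hanti (Set.mem_Ici.2 hxM.le) (Set.mem_Ici.2 hyM.le) hxy).trans
        (hlt.le.trans (hmono ⟨by positivity, hxyr.trans hM⟩ ⟨by positivity, hM⟩ hxyr))
  have hs := h0.trans_le h1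
  -- If the derivative is negative somewhere up to `s`, the increment decreases from `s` to `s₂`; if
  -- not, it increases from `s₁` to `s`.
  by_cases hcase : ∃ x, 0 < x ∧ x ≤ s ∧ phi ρ x < phi ρ (x / r)
  · obtain ⟨x, hx, hxs, hlt⟩ := hcase
    refine hv2.trans (antitoneOn_of_hasDerivWithinAt_nonpos (convex_Ici s)
      (f := fun x => g ρ (x / r) - g ρ x)
      (f' := fun x => (phi ρ x - phi ρ (x / r)) / x) (fun y hy => ?_) (fun y hy => ?_) (fun y hy => ?_)
      (Set.mem_Ici.2 le_rfl) (Set.mem_Ici.2 h2) h2)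
    · exact (hF y (hs.trans_le hy)).continuousAt.continuousWithinAt
    · exact (hF y (hs.trans_le (interior_subset hy))).hasDerivWithinAt
    · have hy : s ≤ y := interior_subset hy
      exact div_nonpos_of_nonpos_of_nonneg
        (sub_nonpos.2 (hsign x y hx (hxs.trans hy) hlt)) (hs.le.trans hy)
  · push Not at hcase
    refine hv1.trans (monotoneOn_of_hasDerivWithinAt_nonneg (convex_Icc s₁ s)
      (f := fun x => g ρ (x / r) - g ρ x)
      (f' := fun x => (phi ρ x - phi ρ (x / r)) / x) (fun y hy => ?_) (fun y hy => ?_) (fun y hy => ?_)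
      (Set.left_mem_Icc.2 h1) (Set.right_mem_Icc.2 h1) h1)
    · exact (hF y (h0.trans_le hy.1)).continuousAt.continuousWithinAt
    · exact (hF y (h0.trans_le (interior_subset hy).1)).hasDerivWithinAt
    · have hy := interior_subset hy
      have hy0 := h0.trans_le hy.1
      exact div_nonneg (sub_nonneg.2 (hcase y hy0 hy.2)) hy0.le

/-! ### MM-estimates. -/

section

variable {p : ℕ} {ρ₁ ρ₂ : ℝ → ℝ} {b ε σ γ : ℝ}

namespace CriticalScales

variable (C : CriticalScales ρ₁ b ε σ γ)
include C

theorem sScale_le {H : Measure (Obs p)} (hH : H ∈ contamination p ε) : sScale ρ₁ b H ≤ σ :=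
  csInf_le ⟨0, fun _ ⟨_, _, h⟩ => h.1.le⟩ ⟨0, 0, C.feasible_zero hH le_rfl⟩

theorem le_sScale_of_forall {H : Measure (Obs p)} (hH : H ∈ contamination p ε) {a : ℝ}
    (h : ∀ α θ, ∀ s ∈ feasibleScales ρ₁ b H α θ, a ≤ s) : a ≤ sScale ρ₁ b H :=
  le_csInf ⟨σ, 0, 0, C.feasible_zero hH le_rfl⟩ fun s ⟨α, θ, hs⟩ => h α θ s hs

theorem le_sScale {H : Measure (Obs p)} (hH : H ∈ contamination p ε) : γ ≤ sScale ρ₁ b H :=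
  C.le_sScale_of_forall hH fun _ _ _ hs =>
    (le_mul_of_one_le_right C.γ_pos.le (by simp)).trans (C.le_of_feasible hH hs)

theorem sBar_eq : sBar p ρ₁ b ε = σ := by
  have hε1 : 0 < 1 - ε := sub_pos.2 C.ε_lt_one
  have hub : ∀ x ∈ sScale ρ₁ b '' contamination p ε, x ≤ σ := by
    rintro _ ⟨H, hH, rfl⟩
    exact C.sScale_le hH
  have hne : (sScale ρ₁ b '' contamination p ε).Nonempty :=
    ⟨_, _, lineContamination_mem 0, rfl⟩
  refine le_antisymm (csSup_le hne hub) (le_of_forall_lt_imp_le_of_dense fun S hS => ?_)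
  rcases le_or_gt S 0 with hS0 | hS0
  · refine le_csSup_of_le ⟨σ, hub⟩ (Set.mem_image_of_mem _ (lineContamination_mem 0)) ?_
    exact hS0.trans (C.γ_pos.le.trans (C.le_sScale (lineContamination_mem 0)))
  obtain ⟨v, hv, hvb⟩ := exists_lt_one_lt_add_mul (C.lt_of_lt_σ hS0 hS)
  obtain ⟨N, hN⟩ := C.isLoss.exists_forall_le_risk_lineContamination (p := p) C.ε_pos.le
    C.ε_lt_one.le hS0 hv
  -- Contamination along the `y`-axis cannot be followed by any slope: the residual of `(N, 0)` is
  -- `N` whatever `θ` is.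
  have hH := lineContamination_mem (ε := ε) ((N, 0) : Obs p)
  refine le_csSup_of_le ⟨σ, hub⟩ (Set.mem_image_of_mem _ hH)
    (C.le_sScale_of_forall hH fun α θ s hs => ?_)
  by_contra! hlt
  have h1 := (hN (N, 0) α θ (by simpa using le_abs_self N) s hs.1 hlt.le).trans hs.2
  have h2 := mul_le_mul_of_nonneg_left (C.isLoss.g_anti hs.1 hlt.le) hε1.le
  linarith

variable (h₂ : IsLoss ρ₂)
include h₂

/-- As `ρ₂ ≤ ρ₁`, the sum is at most `g ρ₁ σ + ε / (1 - ε) = b / (1 - ε)`. This makes the lower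
bound `ℓ` finite. -/
theorem g_add_lt_one (hle : ∀ u, ρ₂ u ≤ ρ₁ u) (hεb : ε < 1 - b) : g ρ₂ σ + ε / (1 - ε) < 1 := by
  have hε1 : 0 < 1 - ε := sub_pos.2 C.ε_lt_one
  have h1 := mul_le_mul_of_nonneg_left (g_mono_loss h₂ C.isLoss hle σ) hε1.le
  have h2 := C.σ_spec
  rw [← lt_sub_iff_add_lt', div_lt_iff₀ hε1]
  nlinarith

/-- Since `s̄ = σ`, `h₁ t` is at least `g ρ₂ (σ / (1 + t)) - g ρ₂ σ`, which equals `ε / (1 - ε)` at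
`t = σ / τ - 1`. This converts the assumption on the S-bias into `τ < γ`. -/
theorem h₁Inv_le (i : Fin p) {τ : ℝ} (hτ : 0 < τ) (hτσ : τ ≤ σ)
    (hτg : g ρ₂ τ = g ρ₂ σ + ε / (1 - ε)) :
    h₁Inv p ρ₁ ρ₂ b ε (ε / (1 - ε)) ≤ σ / τ - 1 := by
  have ht : 0 ≤ σ / τ - 1 := sub_nonneg.2 ((one_le_div hτ).2 hτσ)
  refine csInf_le ⟨0, fun t ht => ht.1⟩ ⟨ht, ?_⟩
  rw [h₁, mFun, C.sBar_eq, h₂.risk_cauchyModel_zero, le_sub_iff_add_le', ← hτg]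
  refine le_csInf ⟨_, EuclideanSpace.single i (σ / τ - 1), 0, by simp [abs_of_nonneg ht], rfl⟩ ?_
  rintro _ ⟨θ, α, hθ, rfl⟩
  have := h₂.g_le_risk_cauchyModel α θ C.σ_pos
  rwa [hθ, add_sub_cancel, div_div_cancel₀ C.σ_pos.ne'] at this

/-- Because `τ < γ`, the radii `r < t` can be taken beyond the S-bias `B`. Slopes of norm at least
`r` then need `ρ₁`-scales of at least `γ (1 + r) ≥ σ`, and contamination handles the smaller ones,
so `s(H)` is close to `σ`. At such a scale `t eᵢ` has smaller `ρ₂`-risk than every slope of norm at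
most `r`. -/
theorem maxBias_MM_ge (i : Fin p) {τ : ℝ} (hτ : 0 < τ) (hτγ : τ < γ)
    (hτg : g ρ₂ τ = g ρ₂ σ + ε / (1 - ε)) (hτ1 : g ρ₂ τ < 1)
    {T : Measure (Obs p) → EuclideanSpace ℝ (Fin p)} (hT : IsMMEstimate ρ₁ ρ₂ b ε T) :
    ENNReal.ofReal (σ / τ - 1) ≤ maxBias T ε := by
  have hε1 : 0 < 1 - ε := sub_pos.2 C.ε_lt_one
  refine ofReal_le_maxBias fun r' t₀ hr' hr't₀ ht₀ => ?_
  set B := σ / γ - 1 with hB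
  have hBτ : B < σ / τ - 1 := by
    rw [hB]
    gcongr
    exact C.σ_pos
  obtain ⟨t, ht1, htτ⟩ := exists_between (max_lt ht₀ hBτ)
  obtain ⟨r, hr, hrt⟩ := exists_between ht1
  have hr0 : 0 ≤ r := hr'.trans (hr't₀.le.trans ((le_max_left _ _).trans hr.le))
  have ht : 0 ≤ t := hr0.trans hrt.le
  have hγr : σ ≤ γ * (1 + r) := by
    have := (le_max_right t₀ B).trans hr.le
    exact (div_le_iff₀' C.γ_pos).1 (by linarith)
  have hrr : r' ≤ r := hr't₀.le.trans ((le_max_left _ _).trans hr.le)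
  have hτt : τ < σ / (1 + t) := by
    rw [lt_div_iff₀ (by positivity)]
    exact (lt_div_iff₀' hτ).1 (by linarith)
  have hg : (1 - ε) * g ρ₂ (σ / (1 + t)) < (1 - ε) * g ρ₂ σ + ε := by
    have h1 := h₂.g_strictAnti hτ hτ1 hτ hτt
    rw [hτg, ← sub_lt_iff_lt_add', lt_div_iff₀ hε1] at h1
    linarith
  -- a scale `S < σ` at which the strict inequality persists
  obtain ⟨S, hS0, hSσ, hSg⟩ : ∃ S, 0 < S ∧ S < σ ∧
      (1 - ε) * g ρ₂ (S / (1 + t)) < (1 - ε) * g ρ₂ σ + ε := by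
    have hc : ContinuousAt (fun s => (1 - ε) * g ρ₂ (s / (1 + t))) σ :=
      continuousAt_const.mul (ContinuousAt.comp (f := fun s => s / (1 + t))
        (h₂.continuousAt_g (div_pos C.σ_pos (by positivity))) (by fun_prop))
    obtain ⟨S, ⟨h1, h2⟩, h3⟩ := (((hc.tendsto.mono_left
      (nhdsWithin_le_nhds (s := Set.Iio σ))).eventually_lt_const hg).and
      (nhdsWithin_le_nhds (Ioi_mem_nhds C.σ_pos))).and self_mem_nhdsWithin |>.exists
    exact ⟨S, h2, h3, h1⟩
  -- `v₁` serves the `ρ₁`-constraint that determines the scale, `v₂` the `ρ₂`-risk that determines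
  -- the fit.
  obtain ⟨v₁, hv₁, hvb₁⟩ := exists_lt_one_lt_add_mul (C.lt_of_lt_σ hS0 hSσ)
  obtain ⟨v₂, hv₂, hvb₂⟩ := exists_lt_one_lt_add_mul hSg
  obtain ⟨N₁, hN₁⟩ := C.isLoss.exists_forall_le_risk_lineContamination (p := p) C.ε_pos.le
    C.ε_lt_one.le hS0 hv₁
  obtain ⟨N₂, hN₂⟩ := h₂.exists_forall_le_risk_lineContamination (p := p) C.ε_pos.le
    C.ε_lt_one.le C.σ_pos hv₂
  obtain ⟨n, hn⟩ := exists_le_abs_mul_sub_inner i (max N₁ N₂) hrt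
  have hH := lineContamination_mem (ε := ε) (n * t, EuclideanSpace.single i n)
  refine ⟨_, hH, ?_⟩
  by_contra! hTr
  set H := lineContamination ε (n * t, EuclideanSpace.single i n) with hHdef
  have hSs : S ≤ sScale ρ₁ b H := by
    refine C.le_sScale_of_forall hH fun α θ s hs => ?_
    rcases le_total r ‖θ‖ with hθ | hθ
    · refine hSσ.le.trans (hγr.trans (le_trans ?_ (C.le_of_feasible hH hs)))
      have := C.γ_pos.le
      gcongr
    · by_contra! hlt
      have h1 := (hN₁ (n * t, EuclideanSpace.single i n) α θ ((le_max_left _ _).trans (hn n le_rfl θ hθ)) s hs.1 hlt.le).trans hs.2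
      have h2 := mul_le_mul_of_nonneg_left (C.isLoss.g_anti hs.1 hlt.le) hε1.le
      linarith
  have hsσ := C.sScale_le hH
  have hs0 := hS0.trans_le hSs
  obtain ⟨α, hmin⟩ := hT H hH
  have h1 := hmin 0 (EuclideanSpace.single i t)
  rw [h₂.risk_lineContamination_single C.ε_pos.le C.ε_lt_one.le i ht] at h1
  have h3 := hN₂ (n * t, EuclideanSpace.single i n) α _ ((le_max_right _ _).trans (hn n le_rfl _ (hTr.trans hrr))) _ hs0 hsσ
  have h4 := mul_le_mul_of_nonneg_left (h₂.g_anti hs0 hsσ) hε1.le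
  -- The actual scale is known only to lie in `[S, σ]`: `S` bounds the risk of `t eᵢ` from above,
  -- `σ` that of its competitors from below.
  have h5 := mul_le_mul_of_nonneg_left
    (h₂.g_anti (s := S / (1 + t)) (s' := sScale ρ₁ b H / (1 + t)) (by positivity) (by gcongr))
    hε1.le
  linarith

/-- Comparison with the zero fit gives `g ρ₂ (s / (1 + ‖T H‖)) - g ρ₂ s ≤ ε / (1 - ε)`.
Quasi-concavity carries the reverse inequality at `K` from the endpoints `γ` and `σ` to `s`, and
strict monotonicity rules out `‖T H‖ > K`. -/
theorem maxBias_MM_le (hreg : GRegular ρ₂) {K : ℝ} (hK : 0 ≤ K)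
    (hγ : ε / (1 - ε) ≤ g ρ₂ (γ / (1 + K)) - g ρ₂ γ)
    (hσ : ε / (1 - ε) ≤ g ρ₂ (σ / (1 + K)) - g ρ₂ σ) (hσ1 : g ρ₂ σ < 1)
    {T : Measure (Obs p) → EuclideanSpace ℝ (Fin p)} (hT : IsMMEstimate ρ₁ ρ₂ b ε T) :
    maxBias T ε ≤ ENNReal.ofReal K := by
  have hε1 : 0 < 1 - ε := sub_pos.2 C.ε_lt_one
  refine iSup₂_le fun H hH => ENNReal.ofReal_le_ofReal ?_
  obtain ⟨α, hmin⟩ := hT H hH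
  set s := sScale ρ₁ b H
  have hs1 : γ ≤ s := C.le_sScale hH
  have hs0 : 0 < s := C.γ_pos.trans_le hs1
  have h1 := (hmin 0 0).trans (h₂.risk_zero_le C.ε_pos.le C.ε_lt_one.le hH s)
  have h2 := (h₂.g_le_risk C.ε_pos.le C.ε_lt_one.le hH α (T H) hs0).trans h1
  have h3 := hreg.le_sub_of_le (by linarith) C.γ_pos hs1 (C.sScale_le hH) hγ hσ
  by_contra! hlt
  have h4 : g ρ₂ (s / (1 + K)) < g ρ₂ (s / (1 + ‖T H‖)) :=
    h₂.g_strictAnti C.σ_pos hσ1 (by positivity) (by gcongr)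
  rw [div_le_iff₀ hε1] at h3
  nlinarith

end CriticalScales

theorem biasExpr_of_pos {s τ : ℝ} (hτ : 0 < τ) (h : gInv ρ₂ (g ρ₂ s + ε / (1 - ε)) = τ) :
    biasExpr ρ₂ ε s = ENNReal.ofReal (s / τ - 1) := by
  rw [biasExpr, h, ← ENNReal.ofReal_div_of_pos hτ, ENNReal.ofReal_sub _ zero_le_one,
    ENNReal.ofReal_one]

/-- As `g ≤ 1`, the inverse is the infimum of all positive scales, namely `0`, and a positive number
divided by `0` is `⊤` in `ℝ≥0∞`. -/
theorem biasExpr_eq_top {s : ℝ} (hs : 0 < s) (h₂ : IsLoss ρ₂) (h : 1 ≤ g ρ₂ s + ε / (1 - ε)) :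
    biasExpr ρ₂ ε s = ⊤ := by
  have : gInv ρ₂ (g ρ₂ s + ε / (1 - ε)) = 0 := by
    have : {s' | 0 < s' ∧ g ρ₂ s' ≤ g ρ₂ s + ε / (1 - ε)} = Set.Ioi 0 := by
      ext s'
      simpa using fun _ => (h₂.g_le_one s').trans h
    rw [gInv, this, csInf_Ioi]
  rw [biasExpr, this, ENNReal.ofReal_zero, ENNReal.div_zero (by simpa using hs)]
  simp

end

end CauchyRegression

/-! ### Assembly of the three statements. -/

theorem mainTheorem8 (p : ℕ) (hp : 1 ≤ p) (b ε : ℝ) (hb : 0 < b) (hε : 0 < ε)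
    (hεb : ε < min b (1 - b)) :
    -- S-estimates
    (∀ (ρ : ℝ → ℝ) (T : MeasureTheory.Measure (Obs p) → EuclideanSpace ℝ (Fin p)),
      IsLoss ρ → (∃ s, 0 < s ∧ g ρ s = (b - ε) / (1 - ε)) → IsSEstimate ρ b ε T →
        maxBias T ε = ENNReal.ofReal (sigmaBE ρ b ε / gammaBE ρ b ε - 1)) ∧
    -- CM-estimates
    (∀ (ρ : ℝ → ℝ) (c : ℝ) (T : MeasureTheory.Measure (Obs p) → EuclideanSpace ℝ (Fin p)),
      IsLoss ρ → (∃ s, 0 < s ∧ g ρ s = (b - ε) / (1 - ε)) → 0 < c → IsCMEstimate ρ b c ε T →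
        maxBias T ε = ENNReal.ofReal (Real.exp (D ρ b c ε + c * ε) - 1)) ∧
    -- MM-estimates
    (∀ (ρ₁ ρ₂ : ℝ → ℝ) (TS T : MeasureTheory.Measure (Obs p) → EuclideanSpace ℝ (Fin p)),
      IsLoss ρ₁ → IsLoss ρ₂ → (∀ u, ρ₂ u ≤ ρ₁ u) →
      (∃ s, 0 < s ∧ g ρ₁ s = (b - ε) / (1 - ε)) →
      IsSEstimate ρ₁ b ε TS →
      maxBias TS ε < ENNReal.ofReal (h₁Inv p ρ₁ ρ₂ b ε (ε / (1 - ε))) →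
      GRegular ρ₂ →
      IsMMEstimate ρ₁ ρ₂ b ε T →
        lowerBd ρ₁ ρ₂ b ε ≤ maxBias T ε ∧
          maxBias T ε ≤ max (lowerBd ρ₁ ρ₂ b ε) (upperBd ρ₁ ρ₂ b ε)) := by
  have i : Fin p := ⟨0, hp⟩
  refine ⟨fun ρ T h hv hT => (criticalScales h hε hεb hv).maxBias_S i hT,
    fun ρ c T h hv hc hT => (criticalScales h hε hεb hv).maxBias_CM i hc hT,
    fun ρ₁ ρ₂ TS T h₁ h₂ hle hv hTS hB hreg hT => ?_⟩
  have C := criticalScales h₁ hε hεb hv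
  rw [C.maxBias_S i hTS] at hB
  rw [lowerBd, upperBd]
  generalize sigmaBE ρ₁ b ε = σ at C hB ⊢
  generalize gammaBE ρ₁ b ε = γ at C hB ⊢
  have hε1 : 0 < 1 - ε := sub_pos.2 C.ε_lt_one
  have hpos : 0 < ε / (1 - ε) := div_pos hε hε1
  have hlt := C.g_add_lt_one h₂ hle (lt_min_iff.1 hεb).2
  have hσn : ∃ s, 0 < s ∧ g ρ₂ s ≤ g ρ₂ σ + ε / (1 - ε) := ⟨σ, C.σ_pos, by linarith⟩
  obtain ⟨τ, hτdef⟩ : ∃ τ, gInv ρ₂ (g ρ₂ σ + ε / (1 - ε)) = τ := ⟨_, rfl⟩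
  have hτ := h₂.gInv_pos hlt hσn
  have hτg := h₂.g_gInv hlt hσn
  have hτσ := gInv_le C.σ_pos (by linarith : g ρ₂ σ ≤ g ρ₂ σ + ε / (1 - ε))
  rw [hτdef] at hτ hτg hτσ
  rw [biasExpr_of_pos hτ hτdef]
  -- The S-bias is `σ / γ - 1`, and by `h₁Inv_le` the assumed bound on it is at most `σ / τ - 1`.
  have hτγ : τ < γ := by
    have h1 := (ENNReal.ofReal_lt_ofReal_iff'.1 hB).1.trans_le (C.h₁Inv_le h₂ i hτ hτσ hτg)
    have h2 : σ / γ < σ / τ := by linarith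
    exact (div_lt_div_iff_of_pos_left C.σ_pos C.γ_pos hτ).1 h2
  refine ⟨C.maxBias_MM_ge h₂ i hτ hτγ hτg (hτg ▸ hlt) hT, ?_⟩
  rcases le_or_gt 1 (g ρ₂ γ + ε / (1 - ε)) with hγ1 | hγ1
  · rw [biasExpr_eq_top C.γ_pos h₂ hγ1]
    simp
  have hγn : ∃ s, 0 < s ∧ g ρ₂ s ≤ g ρ₂ γ + ε / (1 - ε) := ⟨γ, C.γ_pos, by linarith⟩
  have hκ := h₂.gInv_pos hγ1 hγn
  have hκg := h₂.g_gInv hγ1 hγn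
  rw [biasExpr_of_pos hκ rfl, ← ENNReal.ofReal_max]
  generalize gInv ρ₂ (g ρ₂ γ + ε / (1 - ε)) = κ at hκ hκg ⊢
  set K := max (σ / τ - 1) (γ / κ - 1) with hK
  have hK0 : 0 ≤ K := le_max_of_le_left (sub_nonneg.2 ((one_le_div hτ).2 hτσ))
  -- `s / x - 1 ≤ K` means `s / (1 + K) ≤ x`, so the increment with factor `1 + K` is at least `g ρ₂
  -- x - g ρ₂ s`.
  have key : ∀ s x : ℝ, 0 < s → 0 < x → s / x - 1 ≤ K → g ρ₂ x = g ρ₂ s + ε / (1 - ε) →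
      ε / (1 - ε) ≤ g ρ₂ (s / (1 + K)) - g ρ₂ s := fun s x hs hx hxK hgx => by
    have : s / (1 + K) ≤ x := by
      rw [div_le_iff₀ (by positivity)]
      exact (div_le_iff₀' hx).1 (by linarith)
    have := h₂.g_anti (by positivity) this
    linarith
  exact C.maxBias_MM_le h₂ hreg hK0 (key γ κ C.γ_pos hκ (le_max_right _ _) hκg)
    (key σ τ C.σ_pos hτ (le_max_left _ _) hτg) (by linarith) hT
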